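/- For a function $\psi:\mathbb{N}_{\ge 1}\to(0,\infty)$ let $\lambda(\psi)=-\lim_{q\to\infty}\frac{\log\psi(q)}{\log q}$, when this limit exists in $\mathbb{R}$. For an irrational $\theta$, its Diophantine exponent is the infimum of the real numbers $g$ such that $|\theta-p/q|\le q^{-g}$ has only finitely many solutions in integers $p,q$ with $q\geq 1$. For $0<\psi_2\le\psi_1$ and $\theta\in\mathbb{R}$, let $\mathrm{Tight}(\psi_1,\psi_2,\theta)$ be the set of real numbers $x$ such that $$\Big|x-\frac{r-\theta}{q}\Big|\le\psi_1(q)$$ holds for infinitely many pairs $(r,q)$ of relatively prime integers with $q\ge1$, while for every $c>0$ $$\Big|x-\frac{r-\theta}{q}\Big|\le\psi_1(q)-c\,\psi_2(q)$$ holds for only finitely many such pairs. The Fourier dimension $\dim_F E$ of a set $E\subseteq\mathbb{R}$ is the supremum of the $s\in[0,1]$ for which there are a Borel probability measure $\mu$, concentrated on a compact subset of $E$, and a constant $C$ such that $\big|\int e^{-2\pi i\xi x}\,d\mu(x)\big|\le C|\xi|^{-s/2}$ for all real $\xi\ne0$ (with $\dim_F\emptyset=0$). **Theorem.** Let $\theta\in[0,1)$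 be either $0$ or an irrational number with finite Diophantine exponent $\gamma$, taking $\gamma=1$ if $\theta=0$. Let $\psi_1,\psi_2:\mathbb{N}_{\ge1}\to(0,\infty)$ be decreasing (not necessarily strictly) functions with $\psi_2(q)\le\psi_1(q)$ for all $q$ and such that $\psi_1-\psi_2$ is decreasing (not necessarily strictly). Suppose that the orders $\tau_1=\lambda(\psi_1)$ and $\tau_2=\lambda(\psi_2)$ exist and that $\tau_1>1$, and let $\beta=\gamma^{-2}(\tau_1-1)^2$. If $\beta>\tau_2$, then $\dim_F\mathrm{Tight}(\psi_1,\psi_2,\theta)>0$; moreover, $$\dim_F\mathrm{Tight}(\psi_1,\psi_2,\theta)\ \ge\ \frac{2(\beta-\tau_2)}{\tau_2(\beta-1)}.$$ -/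

import Mathlib

open MeasureTheory Filter Topology

noncomputable section

/-- The Fourier transform `ξ ↦ ∫ e^{-2πiξx} dμ(x)` of a measure on the line. -/
def measureFourier (μ : Measure ℝ) (ξ : ℝ) : ℂ :=
  ∫ x, Complex.exp (-(2 * Real.pi * ξ * x : ℝ) * Complex.I) ∂μ

/-- `E` carries a Borel probability measure, concentrated on a compact subset of `E`, whose
Fourier transform is `O(|ξ|^{-s/2})`. -/
def SupportsFourierDecay (E : Set ℝ) (s : ℝ) : Prop :=
  ∃ (μ : Measure ℝ) (K : Set ℝ) (C : ℝ), IsProbabilityMeasure μ ∧ IsCompact K ∧ K ⊆ E ∧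
    μ Kᶜ = 0 ∧ ∀ ξ : ℝ, ξ ≠ 0 → ‖measureFourier μ ξ‖ ≤ C * |ξ| ^ (-s / 2)

/-- The Fourier dimension of a subset of the line. The set of exponents is bounded by `1`, and it
contains `0` as soon as `E` is nonempty; the empty set gets dimension `0`. -/
def fourierDim (E : Set ℝ) : ℝ :=
  sSup {s : ℝ | 0 ≤ s ∧ s ≤ 1 ∧ SupportsFourierDecay E s}

/-- `γ` is the (finite) Diophantine approximation exponent of `θ`: the infimum of the real `g` for
which `|θ - p/q| ≤ q^{-g}` has only finitely many solutions in integers `p`, `q` with `q > 0`.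
As a greatest lower bound in `ℝ`, it exists only if there is such a `g`. -/
def HasDiophantineExponent (θ γ : ℝ) : Prop :=
  IsGLB {g : ℝ | {pq : ℤ × ℕ | 0 < pq.2 ∧
    |θ - (pq.1 : ℝ) / (pq.2 : ℝ)| ≤ (pq.2 : ℝ) ^ (-g)}.Finite} γ

/-- The order `λ(ψ) = - lim log ψ(q) / log q` exists and equals `τ`. -/
def HasOrder (ψ : ℕ → ℝ) (τ : ℝ) : Prop :=
  Tendsto (fun q : ℕ => -(Real.log (ψ q) / Real.log (q : ℝ))) atTop (𝓝 τ)

/-- The pairs `(r, q)` of relatively prime integers, `q > 0`, with `|x - (r - θ)/q| ≤ φ(q)`. -/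
def approxPairs (φ : ℕ → ℝ) (θ x : ℝ) : Set (ℤ × ℕ) :=
  {rq | 0 < rq.2 ∧ IsCoprime rq.1 (rq.2 : ℤ) ∧
    |x - ((rq.1 : ℝ) - θ) / (rq.2 : ℝ)| ≤ φ rq.2}

/-- The set of real numbers of tight approximation order. -/
def Tight (ψ₁ ψ₂ : ℕ → ℝ) (θ : ℝ) : Set ℝ :=
  {x | (approxPairs ψ₁ θ x).Infinite ∧
    ∀ c : ℝ, 0 < c → (approxPairs (fun q => ψ₁ q - c * ψ₂ q) θ x).Finite}

end

/-!
Fix rapidly growing scales with `N (k + 1) = N k ^ (b ^ 2)`, and let `x ∈ [1/4, 3/4]` satisfy, for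
every `k`, `ψ₁ q - ψ₂ q / (k + 1) ≤ x - (r - θ) / q ≤ ψ₁ q` for some `r` and some prime
`q ∈ (N k ^ (1 - ε), N k]`. Since `θ` is zero or has Diophantine exponent `γ`, any other reduced
`(r' - θ) / q'` with `q' ∈ [N k ^ (1 / b), N k ^ b)` is further than `ψ₁ q + ψ₁ q'` from
`(r - θ) / q`, provided `b * γ < τ₁ - 1`. These windows cover all large denominators, so the only
good approximations to `x` are the chosen ones, and `x` is tightly approximable.

Such points carry a measure obtained from a smooth density by multiplying, for each `k`, by the
average over the primes `q` of periodic bumps supported on the admissible intervals, whose length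
is about `N k ^ (-τ₂)`. The `q`-th bump has Fourier coefficients only at multiples of `q`, and an
integer has few prime divisors exceeding `N k ^ (1 - ε)`. Hence, relative to the bound `|ξ| ^ (-a)`
up to frequency `N k ^ τ₂`, the `k`-th multiplication perturbs the Fourier transform by about
`N k ^ (τ₂ * a + τ₂ / b ^ 2 * (1 - a) - 1)`, and the errors are summable when this exponent is
negative. Letting `b ^ 2` increase to `β` gives every `a < (β - τ₂) / (τ₂ * (β - 1))`.
-/

section Fourier

open scoped FourierTransform SchwartzMap ContDiff

theorem exists_norm_fourier_le_of_hasCompactSupport {φ : ℝ → ℂ} (hs : HasCompactSupport φ)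
    (hc : ContDiff ℝ ∞ φ) (L : ℕ) :
    ∃ C : ℝ, 0 < C ∧ ∀ t : ℝ, ‖𝓕 φ t‖ ≤ C / (1 + |t|) ^ L := by
  set g : 𝓢(ℝ, ℂ) := 𝓕 (hs.toSchwartzMap hc) with hg
  have hgφ (t : ℝ) : g t = 𝓕 φ t := by rw [hg, SchwartzMap.fourier_coe]; rfl
  set S := 2 ^ L * ((Finset.Iic (L, 0)).sup fun m => SchwartzMap.seminorm ℝ m.1 m.2) g
  refine ⟨|S| + 1, by positivity, fun t => ?_⟩
  have h := SchwartzMap.one_add_le_sup_seminorm_apply (𝕜 := ℝ) (m := (L, 0)) (k := L) (n := 0)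
    le_rfl le_rfl g t
  rw [norm_iteratedFDeriv_zero, Real.norm_eq_abs] at h
  rw [le_div_iff₀ (by positivity), ← hgφ, mul_comm]
  linarith [le_abs_self S]

theorem fourier_inv_mul_comp_div (φ : ℝ → ℂ) {w : ℝ} (hw : 0 < w) (t : ℝ) :
    𝓕 (fun y => (w : ℂ)⁻¹ * φ (y / w)) t = 𝓕 φ (w * t) := by
  have hw' : (w : ℂ) ≠ 0 := by exact_mod_cast hw.ne'
  simp only [Real.fourier_real_eq, Circle.smul_def, smul_eq_mul]
  calc ∫ y, (𝐞 (-(y * t)) : ℂ) * ((w : ℂ)⁻¹ * φ (y / w))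
      = ∫ y, (w : ℂ)⁻¹ * ((𝐞 (-(y / w * (w * t))) : ℂ) * φ (y / w)) := by
        refine integral_congr_ae (.of_forall fun y => ?_)
        have : y / w * (w * t) = y * t := by field_simp
        simp only [this]
        ring
    _ = ∫ y, (𝐞 (-(y * (w * t))) : ℂ) * φ y := by
        rw [integral_const_mul,
          Measure.integral_comp_div (fun y => (𝐞 (-(y * (w * t))) : ℂ) * φ y) w,
          abs_of_pos hw, Complex.real_smul, inv_mul_cancel_left₀ hw']

theorem fourier_ofReal_zero (ρ : ℝ → ℝ) :
    𝓕 (fun x => (ρ x : ℂ)) 0 = ((∫ x, ρ x : ℝ) : ℂ) := by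
  simp [Real.fourier_real_eq, integral_complex_ofReal]

theorem summable_norm_fourier_intCast {φ : ℝ → ℂ} (hs : HasCompactSupport φ)
    (hc : ContDiff ℝ ∞ φ) : Summable fun m : ℤ => ‖𝓕 φ m‖ := by
  set f := hs.toSchwartzMap hc
  have hO : (fun m : ℤ => (𝓕 f : 𝓢(ℝ, ℂ)) (m : ℝ)) =O[cofinite]
      fun m : ℤ => |(m : ℝ)| ^ (-2 : ℝ) :=
    ((𝓕 f : 𝓢(ℝ, ℂ)).isBigO_cocompact_rpow (-2)).comp_tendsto Int.tendsto_coe_cofinite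
  refine (summable_of_isBigO (Real.summable_abs_int_rpow one_lt_two) hO.norm_left).congr
    fun m => ?_
  rw [SchwartzMap.fourier_coe]
  rfl

theorem hasSum_fourier_periodization {φ : ℝ → ℂ} (hs : HasCompactSupport φ)
    (hc : ContDiff ℝ ∞ φ) (y : ℝ) :
    HasSum (fun m : ℤ => 𝓕 φ m * (𝐞 (m * y) : ℂ)) (∑' n : ℤ, φ (y + n)) := by
  have hsum : Summable fun m : ℤ => 𝓕 φ m * (𝐞 (m * y) : ℂ) :=
    .of_norm <| by
      simpa only [norm_mul, Circle.norm_coe, mul_one] using summable_norm_fourier_intCast hs hc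
  convert hsum.hasSum using 1
  refine (SchwartzMap.tsum_eq_tsum_fourier (hs.toSchwartzMap hc) y).trans
    (tsum_congr fun m => ?_)
  rw [SchwartzMap.fourier_coe, fourier_coe_apply, Real.fourierChar_apply]
  congr 2
  push_cast
  ring

section Bump

variable {c : ℝ} (f : ContDiffBump c)

theorem hasCompactSupport_ofReal_normed :
    HasCompactSupport fun x => (f.normed volume x : ℂ) :=
  f.hasCompactSupport_normed.comp_left Complex.ofReal_zero

theorem contDiff_ofReal_normed : ContDiff ℝ ∞ fun x => (f.normed volume x : ℂ) :=
  Complex.ofRealCLM.contDiff.comp f.contDiff_normed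

theorem exists_norm_fourier_normed_le (L : ℕ) :
    ∃ C : ℝ, 0 < C ∧
      ∀ t : ℝ, ‖𝓕 (fun x => (f.normed volume x : ℂ)) t‖ ≤ C / (1 + |t|) ^ L :=
  exists_norm_fourier_le_of_hasCompactSupport (hasCompactSupport_ofReal_normed f)
    (contDiff_ofReal_normed f) L

end Bump

/-- A smooth probability density supported on `[-1, 1]`. -/
noncomputable def unitBump : ℝ → ℝ :=
  (⟨1 / 2, 1, by norm_num, by norm_num⟩ : ContDiffBump (0 : ℝ)).normed volume

/-- The `1`-periodic approximate identity of mean one at scale `w`: the periodization of the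
dilate of `unitBump` to `[-w, w]`. -/
noncomputable def periodicBump (w y : ℝ) : ℝ :=
  ∑' n : ℤ, w⁻¹ * unitBump ((y + n) / w)

theorem unitBump_nonneg (x : ℝ) : 0 ≤ unitBump x :=
  ContDiffBump.nonneg_normed _ x

theorem abs_le_one_of_unitBump_ne_zero {x : ℝ} (hx : unitBump x ≠ 0) : |x| ≤ 1 := by
  have hx' : x ∈ Function.support unitBump := hx
  rw [unitBump, ContDiffBump.support_normed_eq, Metric.mem_ball, Real.dist_eq, sub_zero] at hx'
  exact hx'.le

theorem fourier_unitBump_zero : 𝓕 (fun x => (unitBump x : ℂ)) 0 = 1 := by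
  rw [fourier_ofReal_zero, unitBump, ContDiffBump.integral_normed, Complex.ofReal_one]

theorem exists_norm_fourier_unitBump_le (L : ℕ) :
    ∃ C : ℝ, 0 < C ∧ ∀ t : ℝ, ‖𝓕 (fun x => (unitBump x : ℂ)) t‖ ≤ C / (1 + |t|) ^ L :=
  exists_norm_fourier_normed_le _ L

section PeriodicBump

variable {w : ℝ}

theorem periodicBump_nonneg (hw : 0 < w) (y : ℝ) : 0 ≤ periodicBump w y :=
  tsum_nonneg fun _ => mul_nonneg (inv_nonneg.2 hw.le) (unitBump_nonneg _)

theorem exists_abs_sub_intCast_le_of_periodicBump_ne_zero (hw : 0 < w) {y : ℝ}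
    (hy : periodicBump w y ≠ 0) : ∃ n : ℤ, |y - n| ≤ w := by
  obtain ⟨n, hn⟩ : ∃ n : ℤ, w⁻¹ * unitBump ((y + n) / w) ≠ 0 := by
    by_contra! hzero
    exact hy (by simp only [periodicBump, hzero, tsum_zero])
  have hle := abs_le_one_of_unitBump_ne_zero (right_ne_zero_of_mul hn)
  rw [abs_div, abs_of_pos hw, div_le_one hw] at hle
  exact ⟨-n, by rwa [Int.cast_neg, sub_neg_eq_add]⟩

theorem hasCompactSupport_dilate_unitBump (hw : 0 < w) :
    HasCompactSupport fun y => (w : ℂ)⁻¹ * (unitBump (y / w) : ℂ) := by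
  have hunit : HasCompactSupport fun x => (unitBump x : ℂ) := hasCompactSupport_ofReal_normed _
  exact (hunit.comp_homeomorph (Homeomorph.mulRight₀ w⁻¹ (inv_ne_zero hw.ne'))).mul_left

theorem contDiff_dilate_unitBump (w : ℝ) :
    ContDiff ℝ ∞ fun y => (w : ℂ)⁻¹ * (unitBump (y / w) : ℂ) :=
  contDiff_const.mul ((contDiff_ofReal_normed _).comp (contDiff_id.div_const w))

theorem summable_norm_fourier_unitBump (hw : 0 < w) :
    Summable fun m : ℤ => ‖𝓕 (fun x => (unitBump x : ℂ)) (w * m)‖ :=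
  (summable_norm_fourier_intCast (hasCompactSupport_dilate_unitBump hw)
    (contDiff_dilate_unitBump w)).congr fun m => by
      rw [fourier_inv_mul_comp_div (fun x => (unitBump x : ℂ)) hw]

theorem hasSum_periodicBump (hw : 0 < w) (y : ℝ) :
    HasSum (fun m : ℤ => 𝓕 (fun x => (unitBump x : ℂ)) (w * m) * (𝐞 (m * y) : ℂ))
      (periodicBump w y) := by
  have h := hasSum_fourier_periodization (hasCompactSupport_dilate_unitBump hw)
    (contDiff_dilate_unitBump w) y
  simp only [fourier_inv_mul_comp_div (fun x => (unitBump x : ℂ)) hw] at h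
  convert h
  simp only [periodicBump, Complex.ofReal_tsum, Complex.ofReal_mul, Complex.ofReal_inv]

theorem continuous_periodicBump (hw : 0 < w) : Continuous (periodicBump w) := by
  have hcont : Continuous fun y : ℝ => ∑' m : ℤ,
      𝓕 (fun x => (unitBump x : ℂ)) (w * m) * (𝐞 (m * y) : ℂ) := by
    refine continuous_tsum (fun m => ?_) (summable_norm_fourier_unitBump hw)
      fun m y => by rw [norm_mul, Circle.norm_coe, mul_one]
    simp only [Real.fourierChar_apply]
    fun_prop
  simp only [(hasSum_periodicBump hw _).tsum_eq] at hcont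
  exact Complex.continuous_re.comp hcont

end PeriodicBump

end Fourier

section LatticeSums

theorem mul_rpow_mul_sub_le_rpow_sub_rpow {x y p : ℝ} (hx : 0 ≤ x) (hy : 0 < y) (hp₀ : 0 ≤ p)
    (hp₁ : p ≤ 1) : p * y ^ (p - 1) * (y - x) ≤ y ^ p - x ^ p := by
  have hbernoulli : (x / y) ^ p ≤ 1 + p * (x / y - 1) := by
    have h := rpow_one_add_le_one_add_mul_self (s := x / y - 1)
      (by linarith [div_nonneg hx hy.le]) hp₀ hp₁
    rwa [add_sub_cancel] at h
  rw [Real.div_rpow hx hy.le, div_le_iff₀ (by positivity)] at hbernoulli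
  have hsplit : p * y ^ (p - 1) * (y - x) = y ^ p - (1 + p * (x / y - 1)) * y ^ p := by
    rw [Real.rpow_sub_one hy.ne']
    field_simp
    ring
  linarith

theorem inv_rpow_mul_sq_le_sub {a m : ℝ} (ha₀ : 0 ≤ a) (ha₁ : a < 1) (hm : 1 ≤ m) (i : ℕ) :
    ((1 + (i : ℝ)) ^ a * (1 + i / m) ^ 2)⁻¹ ≤ 2 / (1 - a) * m ^ (1 - a) *
      ((((i + 1 : ℕ) : ℝ) / (m + (i + 1 : ℕ))) ^ (1 - a) - (i / (m + i)) ^ (1 - a)) := by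
  have hm₀ : 0 < m := by linarith
  have hgap : 0 < 1 - a := sub_pos.2 ha₁
  set x : ℝ := i / (m + i)
  set y : ℝ := (i + 1 : ℕ) / (m + (i + 1 : ℕ)) with hy
  have hy₀ : 0 < y := by positivity
  have hconcave := mul_rpow_mul_sub_le_rpow_sub_rpow (x := x) (by positivity) hy₀ hgap.le
    (by linarith)
  have hlower : (m / (1 + i)) ^ a ≤ y ^ (1 - a - 1) := by
    have : y ≤ (1 + i) / m := by
      rw [hy]; push_cast
      rw [div_le_div_iff₀ (by positivity) hm₀]
      nlinarith
    rw [show 1 - a - 1 = -a by ring, Real.rpow_neg hy₀.le, ← Real.inv_rpow hy₀.le]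
    refine Real.rpow_le_rpow (by positivity) ?_ ha₀
    rw [← inv_div]
    exact inv_anti₀ hy₀ this
  have hdiff : m⁻¹ / (2 * (1 + i / m) ^ 2) ≤ y - x := by
    have : y - x = m / ((m + i) * (m + i + 1)) := by
      simp only [hy, x]; push_cast; field_simp; ring
    rw [this]
    have e : m⁻¹ / (2 * (1 + i / m) ^ 2) = m / ((m + i) * (2 * (m + i))) := by field_simp
    rw [e]
    gcongr
    linarith
  calc ((1 + (i : ℝ)) ^ a * (1 + i / m) ^ 2)⁻¹
      = 2 / (1 - a) * m ^ (1 - a) *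
        ((1 - a) * (m / (1 + i)) ^ a * (m⁻¹ / (2 * (1 + i / m) ^ 2))) := by
        rw [Real.div_rpow hm₀.le (by positivity), Real.rpow_sub hm₀, Real.rpow_one]
        field_simp
    _ ≤ _ := by
        gcongr
        exact le_trans (by gcongr) hconcave

theorem sum_range_inv_rpow_mul_sq_le {a m : ℝ} (ha₀ : 0 ≤ a) (ha₁ : a < 1) (hm : 1 ≤ m)
    (n : ℕ) :
    ∑ i ∈ Finset.range n, ((1 + (i : ℝ)) ^ a * (1 + i / m) ^ 2)⁻¹ ≤
      2 / (1 - a) * m ^ (1 - a) := by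
  have hgap : 0 < 1 - a := sub_pos.2 ha₁
  refine (Finset.sum_le_sum fun i _ => inv_rpow_mul_sq_le_sub ha₀ ha₁ hm i).trans ?_
  rw [← Finset.mul_sum, Finset.sum_range_sub fun i : ℕ => ((i : ℝ) / (m + i)) ^ (1 - a)]
  refine mul_le_of_le_one_right (by positivity) ?_
  rw [Nat.cast_zero, zero_div, Real.zero_rpow hgap.ne', sub_zero]
  exact Real.rpow_le_one (by positivity)
    ((div_le_one (by positivity)).2 (by linarith)) hgap.le

theorem sum_comp_abs_sub_intCast_le {f : ℝ → ℝ} (hf : AntitoneOn f (Set.Ici 0))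
    (hf₀ : ∀ x, 0 ≤ f x) {K : ℝ} (hK : ∀ n : ℕ, ∑ i ∈ Finset.range n, f i ≤ K) (ξ : ℝ)
    (S : Finset ℤ) : ∑ s ∈ S, f |ξ - s| ≤ 2 * K := by
  classical
  have hside (T : Finset ℤ) (e : ℤ → ℕ) (hinj : Set.InjOn e T)
      (he : ∀ s ∈ T, (e s : ℝ) ≤ |ξ - s|) : ∑ s ∈ T, f |ξ - s| ≤ K := by
    obtain ⟨n, hn⟩ := (T.image e).exists_nat_subset_range
    calc ∑ s ∈ T, f |ξ - s| ≤ ∑ s ∈ T, f (e s) :=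
          Finset.sum_le_sum fun s hs =>
            hf (Set.mem_Ici.2 (Nat.cast_nonneg _)) (Set.mem_Ici.2 (abs_nonneg _)) (he s hs)
      _ = ∑ i ∈ T.image e, f i := (Finset.sum_image (f := fun i : ℕ => f i) hinj).symm
      _ ≤ ∑ i ∈ Finset.range n, f i := Finset.sum_le_sum_of_subset_of_nonneg hn fun _ _ _ => hf₀ _
      _ ≤ K := hK n
  rw [← Finset.sum_filter_add_sum_filter_not S fun s => s ≤ ⌊ξ⌋, two_mul]
  refine add_le_add (hside _ (fun s => (⌊ξ⌋ - s).toNat) ?_ ?_)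
    (hside _ (fun s => (s - (⌊ξ⌋ + 1)).toNat) ?_ ?_)
  · intro s hs s' hs' h
    simp only [Finset.coe_filter, Set.mem_ofPred_eq] at hs hs' h
    lia
  · intro s hs
    have hs' : (0 : ℤ) ≤ ⌊ξ⌋ - s := sub_nonneg.2 (Finset.mem_filter.1 hs).2
    rw [← Int.cast_natCast, Int.toNat_of_nonneg hs']
    push_cast
    linarith [le_abs_self (ξ - s), Int.floor_le ξ]
  · intro s hs s' hs' h
    simp only [Finset.coe_filter, Set.mem_ofPred_eq] at hs hs' h
    lia
  · intro s hs
    have hs' : 0 ≤ s - (⌊ξ⌋ + 1) := by have := (Finset.mem_filter.1 hs).2; lia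
    rw [← Int.cast_natCast, Int.toNat_of_nonneg hs']
    push_cast
    linarith [neg_abs_le (ξ - s), Int.lt_floor_add_one ξ]

theorem sum_inv_rpow_mul_sq_abs_sub_intCast_le {a m : ℝ} (ha₀ : 0 ≤ a) (ha₁ : a < 1)
    (hm : 1 ≤ m) (ξ : ℝ) (S : Finset ℤ) :
    ∑ s ∈ S, ((1 + |ξ - s|) ^ a * (1 + |ξ - s| / m) ^ 2)⁻¹ ≤ 4 / (1 - a) * m ^ (1 - a) := by
  have : 0 < m := by linarith
  have hanti : AntitoneOn (fun x : ℝ => ((1 + |x|) ^ a * (1 + |x| / m) ^ 2)⁻¹) (Set.Ici 0) := by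
    intro x hx y hy hxy
    rw [Set.mem_Ici] at hx hy
    simp only [abs_of_nonneg hx, abs_of_nonneg hy]
    gcongr
  have h := sum_comp_abs_sub_intCast_le hanti (fun x => by positivity)
    (fun n => by
      simpa only [Nat.abs_cast] using sum_range_inv_rpow_mul_sq_le ha₀ ha₁ hm n) ξ S
  simp only [abs_abs] at h
  linarith [show 2 * (2 / (1 - a) * m ^ (1 - a)) = 4 / (1 - a) * m ^ (1 - a) by ring]

end LatticeSums

section DecayWeight

/-- The majorant of the Fourier transform of a density oscillating at frequencies up to about `m`:
polynomial decay of order `a` throughout, and cubic decay in addition beyond `m`. -/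
noncomputable def decayWeight (a m t : ℝ) : ℝ :=
  ((1 + |t|) ^ a * (1 + |t| / m) ^ 3)⁻¹

variable {a m M : ℝ}

theorem decayWeight_nonneg (hm : 0 ≤ m) (t : ℝ) : 0 ≤ decayWeight a m t := by
  unfold decayWeight; positivity

theorem decayWeight_zero_right (a m : ℝ) : decayWeight a m 0 = 1 := by
  simp [decayWeight]

theorem decayWeight_mono_scale (hm : 0 < m) (hmM : m ≤ M) (t : ℝ) :
    decayWeight a m t ≤ decayWeight a M t := by
  have hM : 0 < M := hm.trans_le hmM
  unfold decayWeight
  gcongr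

theorem decayWeight_le_rpow (ha : 0 ≤ a) (hm : 0 ≤ m) {t : ℝ} (ht : t ≠ 0) :
    decayWeight a m t ≤ |t| ^ (-a) := by
  rw [decayWeight, Real.rpow_neg (abs_nonneg t)]
  refine inv_anti₀ (by positivity) ?_
  calc |t| ^ a ≤ (1 + |t|) ^ a := by gcongr; linarith
    _ ≤ (1 + |t|) ^ a * (1 + |t| / m) ^ 3 :=
      le_mul_of_one_le_right (by positivity)
        (one_le_pow₀ (le_add_of_nonneg_right (by positivity)))

theorem inv_one_add_abs_pow_four_le_decayWeight (ha₁ : a ≤ 1) (hm : 1 ≤ m) (t : ℝ) :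
    ((1 + |t|) ^ 4)⁻¹ ≤ decayWeight a m t := by
  have h : 1 ≤ 1 + |t| := by linarith [abs_nonneg t]
  refine inv_anti₀ (by positivity) ?_
  calc (1 + |t|) ^ a * (1 + |t| / m) ^ 3 ≤ (1 + |t|) ^ (1 : ℝ) * (1 + |t|) ^ 3 := by
        gcongr
        exact div_le_self (abs_nonneg t) hm
    _ = (1 + |t|) ^ 4 := by rw [Real.rpow_one]; ring

theorem one_add_abs_add_div_le_mul (hM : 0 ≤ M) (s t : ℝ) :
    1 + |s + t| / M ≤ (1 + |s| / M) * (1 + |t| / M) := by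
  have h : |s + t| / M ≤ |s| / M + |t| / M := by
    rw [← add_div]
    exact div_le_div_of_nonneg_right (abs_add_le s t) hM
  linarith [mul_nonneg (div_nonneg (abs_nonneg s) hM) (div_nonneg (abs_nonneg t) hM)]

theorem inv_decayWeight_add_le (ha₀ : 0 ≤ a) (ha₁ : a ≤ 1) (hM : 1 ≤ M) (s t : ℝ) :
    (decayWeight a M (s + t))⁻¹ ≤
      M ^ a * (1 + |s| / M) ^ 4 * ((1 + |t| / M) ^ a * (1 + |t| / M) ^ 3) := by
  have hM₀ : 0 < M := by linarith
  have hA : 1 ≤ 1 + |s| / M := le_add_of_nonneg_right (by positivity)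
  have hscale : 1 + |s + t| ≤ M * (1 + |s + t| / M) := by field_simp; linarith
  have hpeetre := one_add_abs_add_div_le_mul hM₀.le s t
  rw [decayWeight, inv_inv]
  calc (1 + |s + t|) ^ a * (1 + |s + t| / M) ^ 3
      ≤ (M * ((1 + |s| / M) * (1 + |t| / M))) ^ a *
        ((1 + |s| / M) * (1 + |t| / M)) ^ 3 := by
        gcongr
        exact hscale.trans (by gcongr)
    _ = M ^ a * ((1 + |s| / M) ^ a * (1 + |s| / M) ^ 3) *
        ((1 + |t| / M) ^ a * (1 + |t| / M) ^ 3) := by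
        rw [Real.mul_rpow hM₀.le (by positivity), Real.mul_rpow (by positivity) (by positivity)]
        ring
    _ ≤ M ^ a * (1 + |s| / M) ^ 4 * ((1 + |t| / M) ^ a * (1 + |t| / M) ^ 3) := by
        gcongr
        calc (1 + |s| / M) ^ a * (1 + |s| / M) ^ 3
            ≤ (1 + |s| / M) ^ (1 : ℝ) * (1 + |s| / M) ^ 3 := by gcongr
          _ = (1 + |s| / M) ^ 4 := by rw [Real.rpow_one]; ring

theorem rpow_mul_cube_le_of_le (ha₀ : 0 ≤ a) (ha₁ : a ≤ 1) (hm : 1 ≤ m) (hmM : m ≤ M) (t : ℝ) :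
    (1 + |t| / M) ^ a * (1 + |t| / M) ^ 3 ≤
      4 * ((1 + |t| / m) + (m / M) ^ 3 * ((1 + |t|) ^ a * (1 + |t| / m) ^ 3)) := by
  have hm₀ : 0 < m := by linarith
  have hM₀ : 0 < M := by linarith
  have hB : 1 ≤ 1 + |t| / M := le_add_of_nonneg_right (by positivity)
  have hcube : (1 + |t| / M) ^ 3 ≤ 4 * (1 + (m / M * (1 + |t| / m)) ^ 3) := by
    have hle : 1 + |t| / M ≤ 1 + m / M * (1 + |t| / m) := by
      rw [mul_add, div_mul_div_cancel₀' hm₀.ne']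
      linarith [div_pos hm₀ hM₀]
    calc (1 + |t| / M) ^ 3 ≤ (1 + m / M * (1 + |t| / m)) ^ 3 := by gcongr
      _ ≤ 2 ^ (3 - 1) * (1 ^ 3 + (m / M * (1 + |t| / m)) ^ 3) :=
        add_pow_le zero_le_one (by positivity) 3
      _ = _ := by norm_num
  have hlow : (1 + |t| / M) ^ a ≤ 1 + |t| / m :=
    (Real.rpow_le_self_of_one_le hB ha₁).trans (by gcongr)
  have hhigh : (1 + |t| / M) ^ a ≤ (1 + |t|) ^ a := by
    gcongr
    exact div_le_self (abs_nonneg t) (hm.trans hmM)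
  calc (1 + |t| / M) ^ a * (1 + |t| / M) ^ 3
      ≤ (1 + |t| / M) ^ a * (4 * (1 + (m / M * (1 + |t| / m)) ^ 3)) := by gcongr
    _ = 4 * ((1 + |t| / M) ^ a + (1 + |t| / M) ^ a * (m / M * (1 + |t| / m)) ^ 3) := by ring
    _ ≤ 4 * ((1 + |t| / m) + (1 + |t|) ^ a * (m / M * (1 + |t| / m)) ^ 3) := by gcongr
    _ = _ := by ring

theorem decayWeight_le_mul_decayWeight_add (ha₀ : 0 ≤ a) (ha₁ : a ≤ 1) (hm : 1 ≤ m)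
    (hmM : m ≤ M) (s t : ℝ) :
    decayWeight a m t ≤ 4 * M ^ a * decayWeight a M (s + t) * (1 + |s| / M) ^ 4 *
      (((1 + |t|) ^ a * (1 + |t| / m) ^ 2)⁻¹ + (m / M) ^ 3) := by
  have : 0 < m := by linarith
  have hM₀ : 0 < M := by linarith
  have hW : 0 < decayWeight a M (s + t) := by unfold decayWeight; positivity
  have hkey : (decayWeight a M (s + t))⁻¹ ≤ M ^ a * (1 + |s| / M) ^ 4 *
      (4 * ((1 + |t| / m) + (m / M) ^ 3 * ((1 + |t|) ^ a * (1 + |t| / m) ^ 3))) :=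
    (inv_decayWeight_add_le ha₀ ha₁ (hm.trans hmM) s t).trans
      (mul_le_mul_of_nonneg_left (rpow_mul_cube_le_of_le ha₀ ha₁ hm hmM t) (by positivity))
  rw [inv_le_iff_one_le_mul₀ hW] at hkey
  rw [decayWeight, inv_le_iff_one_le_mul₀ (by positivity)]
  refine hkey.trans_eq ?_
  field_simp

theorem inv_pow_mul_decayWeight_le (ha₀ : 0 ≤ a) (ha₁ : a ≤ 1) (hm : 1 ≤ m) (hmM : m ≤ M)
    (s t : ℝ) :
    ((1 + |s| / M) ^ 6)⁻¹ * decayWeight a m t ≤ 4 * M ^ a * decayWeight a M (s + t) *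
      (((1 + |t|) ^ a * (1 + |t| / m) ^ 2)⁻¹ + (m / M) ^ 3 * ((1 + |s| / M) ^ 2)⁻¹) := by
  have hM₀ : 0 < M := by linarith
  have hW := decayWeight_nonneg (a := a) hM₀.le (s + t)
  have hA : 1 ≤ 1 + |s| / M := le_add_of_nonneg_right (by positivity)
  have h := decayWeight_le_mul_decayWeight_add ha₀ ha₁ hm hmM s t
  set A := 1 + |s| / M
  set X := ((1 + |t|) ^ a * (1 + |t| / m) ^ 2)⁻¹
  have hX : 0 ≤ X := by positivity
  calc (A ^ 6)⁻¹ * decayWeight a m t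
      ≤ (A ^ 6)⁻¹ * (4 * M ^ a * decayWeight a M (s + t) * A ^ 4 * (X + (m / M) ^ 3)) := by
        gcongr
    _ = 4 * M ^ a * decayWeight a M (s + t) * ((A ^ 2)⁻¹ * X + (m / M) ^ 3 * (A ^ 2)⁻¹) := by
        field_simp
    _ ≤ 4 * M ^ a * decayWeight a M (s + t) * (X + (m / M) ^ 3 * (A ^ 2)⁻¹) := by
        gcongr
        exact mul_le_of_le_one_left hX (inv_le_one_of_one_le₀ (one_le_pow₀ hA))

theorem sum_inv_pow_mul_decayWeight_le (ha₀ : 0 ≤ a) (ha₁ : a < 1) (hm : 1 ≤ m)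
    (hmM : m ^ 2 ≤ M) (ξ : ℝ) (S : Finset ℤ) :
    ∑ s ∈ S, ((1 + |(s : ℝ)| / M) ^ 6)⁻¹ * decayWeight a m (ξ - s) ≤
      32 / (1 - a) * M ^ a * m ^ (1 - a) * decayWeight a M ξ := by
  have hmM' : m ≤ M := (le_self_pow₀ hm two_ne_zero).trans hmM
  have hM : 1 ≤ M := hm.trans hmM'
  have hM₀ : 0 < M := by linarith
  have hgap : 0 < 1 - a := sub_pos.2 ha₁
  have hW := decayWeight_nonneg (a := a) hM₀.le ξ
  have hnear := sum_inv_rpow_mul_sq_abs_sub_intCast_le ha₀ ha₁ hm ξ S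
  have hfar : ∑ s ∈ S, ((1 + |(s : ℝ)| / M) ^ 2)⁻¹ ≤ 4 * M := by
    simpa using sum_inv_rpow_mul_sq_abs_sub_intCast_le le_rfl zero_lt_one hM 0 S
  have hratio : (m / M) ^ 3 * (4 * M) ≤ 4 / (1 - a) * m ^ (1 - a) := by
    have hcube : m ^ 3 / M ^ 2 ≤ 1 := by
      rw [div_le_one (by positivity)]
      calc m ^ 3 ≤ (m ^ 2) ^ 2 := by rw [← pow_mul]; exact pow_le_pow_right₀ hm (by norm_num)
        _ ≤ M ^ 2 := by gcongr
    have hone : 1 ≤ (1 - a)⁻¹ * m ^ (1 - a) :=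
      one_le_mul_of_one_le_of_one_le ((one_le_inv₀ hgap).2 (by linarith))
        (Real.one_le_rpow hm hgap.le)
    calc (m / M) ^ 3 * (4 * M) = 4 * (m ^ 3 / M ^ 2) := by field_simp
      _ ≤ 4 * ((1 - a)⁻¹ * m ^ (1 - a)) := by gcongr; exact hcube.trans hone
      _ = 4 / (1 - a) * m ^ (1 - a) := by ring
  calc _ ≤ ∑ s ∈ S, 4 * M ^ a * decayWeight a M ξ *
        (((1 + |ξ - s|) ^ a * (1 + |ξ - s| / m) ^ 2)⁻¹ +
          (m / M) ^ 3 * ((1 + |(s : ℝ)| / M) ^ 2)⁻¹) := Finset.sum_le_sum fun s _ => by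
        simpa only [add_sub_cancel] using
          inv_pow_mul_decayWeight_le ha₀ ha₁.le hm hmM' s (ξ - s)
    _ ≤ 4 * M ^ a * decayWeight a M ξ *
        (4 / (1 - a) * m ^ (1 - a) + 4 / (1 - a) * m ^ (1 - a)) := by
        rw [← Finset.mul_sum, Finset.sum_add_distrib, ← Finset.mul_sum]
        refine mul_le_mul_of_nonneg_left (add_le_add hnear (le_trans ?_ hratio)) (by positivity)
        gcongr
    _ = _ := by ring

end DecayWeight

section Primes

/-- The primes in the interval `(Y, N]`, the denominators used at one step of the construction. -/
noncomputable def primesIoc (Y N : ℝ) : Finset ℕ :=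
  {p ∈ Nat.primesLE ⌊N⌋₊ | Y < p}

theorem mem_primesIoc {Y N : ℝ} (hN : 0 ≤ N) {p : ℕ} :
    p ∈ primesIoc Y N ↔ p.Prime ∧ Y < p ∧ (p : ℝ) ≤ N := by
  rw [primesIoc, Finset.mem_filter, Nat.mem_primesLE, Nat.le_floor_iff hN]
  tauto

theorem pow_card_le_abs_of_prime_of_dvd {Q : Finset ℕ} {Y : ℝ} {s : ℤ} (hY : 0 ≤ Y)
    (hQ : ∀ q ∈ Q, q.Prime ∧ Y ≤ q ∧ (q : ℤ) ∣ s) (hs : s ≠ 0) :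
    Y ^ Q.card ≤ |(s : ℝ)| := by
  have hdvd : ∏ q ∈ Q, q ∣ s.natAbs :=
    Finset.prod_primes_dvd _ (fun q hq => (hQ q hq).1.prime)
      fun q hq => Int.natCast_dvd.1 (hQ q hq).2.2
  calc Y ^ Q.card = ∏ _q ∈ Q, Y := by rw [Finset.prod_const]
    _ ≤ ∏ q ∈ Q, (q : ℝ) := Finset.prod_le_prod (fun _ _ => hY) fun q hq => (hQ q hq).2.1
    _ = ((∏ q ∈ Q, q : ℕ) : ℝ) := (Nat.cast_prod _ _).symm
    _ ≤ (s.natAbs : ℝ) := by exact_mod_cast Nat.le_of_dvd (Int.natAbs_pos.2 hs) hdvd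
    _ = |(s : ℝ)| := by rw [Nat.cast_natAbs, Int.cast_abs]

theorem card_prime_dvd_le {P : Finset ℕ} {Y M D : ℝ} (hP : ∀ q ∈ P, q.Prime ∧ Y ≤ q)
    (hY : 0 < Y) (hlog : 1 ≤ Real.log Y) (hM : 0 < M) (hD : 1 ≤ D)
    (hMD : Real.log M ≤ D * Real.log Y) {s : ℤ} (hs : s ≠ 0) :
    (({q ∈ P | (q : ℤ) ∣ s} : Finset ℕ).card : ℝ) ≤ D * (1 + |(s : ℝ)| / M) := by
  set Q : Finset ℕ := {q ∈ P | (q : ℤ) ∣ s}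
  have hs₀ : 0 < |(s : ℝ)| := abs_pos.2 (by exact_mod_cast hs)
  have hratio : 0 < |(s : ℝ)| / M := div_pos hs₀ hM
  have hcard : (Q.card : ℝ) * Real.log Y ≤ Real.log |(s : ℝ)| := by
    rw [← Real.log_pow]
    refine Real.log_le_log (by positivity)
      (pow_card_le_abs_of_prime_of_dvd hY.le (fun q hq => ?_) hs)
    obtain ⟨hqP, hqs⟩ := Finset.mem_filter.1 hq
    exact ⟨(hP q hqP).1, (hP q hqP).2, hqs⟩
  have hlogs : Real.log |(s : ℝ)| ≤ Real.log M + |(s : ℝ)| / M := by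
    have := Real.log_le_sub_one_of_pos hratio
    rw [Real.log_div hs₀.ne' hM.ne'] at this
    linarith
  have hDY : 1 ≤ D * Real.log Y := one_le_mul_of_one_le_of_one_le hD hlog
  refine le_of_mul_le_mul_right ?_ (zero_lt_one.trans_le hlog)
  linarith [le_mul_of_one_le_right hratio.le hDY]

theorem primeCounting_floor_le_card_primesIoc_add {Y : ℝ} (hY : 0 ≤ Y) (N : ℝ) :
    (Nat.primeCounting ⌊N⌋₊ : ℝ) ≤ (primesIoc Y N).card + Y := by
  have hsmall : (({p ∈ Nat.primesLE ⌊N⌋₊ | ¬ Y < p} : Finset ℕ).card : ℝ) ≤ Y := by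
    have hsub : ({p ∈ Nat.primesLE ⌊N⌋₊ | ¬ Y < p} : Finset ℕ) ⊆ Finset.Icc 1 ⌊Y⌋₊ := by
      intro p hp
      obtain ⟨hprime, hle⟩ := Finset.mem_filter.1 hp
      rw [Finset.mem_Icc, Nat.le_floor_iff hY]
      exact ⟨(Nat.mem_primesLE.1 hprime).2.one_le, not_lt.1 hle⟩
    have hcard := Finset.card_le_card hsub
    rw [Nat.card_Icc, Nat.add_sub_cancel] at hcard
    exact le_trans (by exact_mod_cast hcard) (Nat.floor_le hY)
  rw [← Nat.primesLE_card_eq_primeCounting,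
    ← Finset.card_filter_add_card_filter_not (fun p : ℕ => Y < p), Nat.cast_add]
  exact add_le_add le_rfl hsmall

theorem eventually_two_mul_rpow_le_primeCounting {s : ℝ} (hs : s < 1) :
    ∀ᶠ N : ℝ in atTop, 2 * N ^ s ≤ Nat.primeCounting ⌊N⌋₊ := by
  have hlog : ∀ᶠ N : ℝ in atTop, Real.log N ≤ N ^ (1 - s) / 8 := by
    have h := (isLittleO_log_rpow_atTop (sub_pos.2 hs)).def (by norm_num : (0 : ℝ) < 1 / 8)
    filter_upwards [h, eventually_ge_atTop 1] with N h hN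
    rw [Real.norm_of_nonneg (Real.log_nonneg hN), Real.norm_of_nonneg (by positivity)] at h
    linarith
  have hlog_add : ∀ᶠ N : ℝ in atTop, Real.log (N + 2) ≤ N / 8 := by
    have h := (tendsto_atTop_add_const_right atTop (2 : ℝ) tendsto_id).eventually
      (Real.isLittleO_log_id_atTop.def (by norm_num : (0 : ℝ) < 1 / 16))
    filter_upwards [h, eventually_ge_atTop 2] with N h hN
    simp only [id] at h
    rw [Real.norm_of_nonneg (Real.log_nonneg (by linarith)),
      Real.norm_of_nonneg (by linarith)] at h
    linarith
  filter_upwards [hlog, hlog_add, eventually_ge_atTop 16] with N hlog hlog_add hN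
  have hN₀ : 0 < N := by linarith
  refine le_trans ?_ (Chebyshev.pi_ge' (x := N) (by linarith))
  rw [le_div_iff₀ (Real.log_pos (by linarith))]
  have hmain : N ^ s * Real.log N ≤ N / 8 := by
    calc N ^ s * Real.log N ≤ N ^ s * (N ^ (1 - s) / 8) := by gcongr
      _ = N / 8 := by rw [← mul_div_assoc, ← Real.rpow_add hN₀]; simp
  nlinarith [Real.log_two_gt_d9]

theorem eventually_rpow_le_card_primesIoc {s : ℝ} (hs : s < 1) :
    ∀ᶠ N : ℝ in atTop, N ^ s ≤ (primesIoc (N ^ s) N).card := by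
  filter_upwards [eventually_two_mul_rpow_le_primeCounting hs, eventually_ge_atTop 0]
    with N hπ hN
  linarith [primeCounting_floor_le_card_primesIoc_add (Real.rpow_nonneg hN s) N]

theorem sum_sum_mul_le_sum_card_dvd_mul {G : ℤ → ℝ} (hG : ∀ s, 0 ≤ G s) (S : Finset ℤ)
    {P : Finset ℕ} (hP : ∀ q ∈ P, q ≠ 0) :
    ∑ m ∈ S, ∑ q ∈ P, G (m * q) ≤ ∑ s ∈ (S ×ˢ P).image fun x => x.1 * (x.2 : ℤ),
      (({q ∈ P | (q : ℤ) ∣ s} : Finset ℕ).card : ℝ) * G s := by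
  rw [← Finset.sum_product', ← Finset.sum_fiberwise_of_maps_to
    (g := fun x : ℤ × ℕ => x.1 * (x.2 : ℤ)) (fun x hx => Finset.mem_image_of_mem _ hx)]
  refine Finset.sum_le_sum fun s _ => ?_
  set Q : Finset (ℤ × ℕ) := {x ∈ S ×ˢ P | x.1 * (x.2 : ℤ) = s}
  have hmem {x : ℤ × ℕ} (hx : x ∈ Q) : x.2 ∈ P ∧ x.1 * (x.2 : ℤ) = s :=
    (Finset.mem_filter.1 hx).imp_left fun h => (Finset.mem_product.1 h).2
  have hcard : Q.card ≤ ({q ∈ P | (q : ℤ) ∣ s} : Finset ℕ).card := by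
    refine Finset.card_le_card_of_injOn Prod.snd (fun x hx => ?_) fun x hx y hy hxy => ?_
    · exact Finset.mem_coe.2 <|
        Finset.mem_filter.2 ⟨(hmem hx).1, Dvd.intro_left _ (hmem hx).2⟩
    · have hne : (x.2 : ℤ) ≠ 0 := by exact_mod_cast hP _ (hmem hx).1
      refine Prod.ext (mul_right_cancel₀ hne ?_) hxy
      rw [(hmem hx).2, hxy, (hmem hy).2]
  calc ∑ x ∈ Q, G (x.1 * (x.2 : ℤ)) = ∑ _x ∈ Q, G s :=
        Finset.sum_congr rfl fun x hx => by rw [(hmem hx).2]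
    _ = (Q.card : ℝ) * G s := by rw [Finset.sum_const, nsmul_eq_mul]
    _ ≤ _ := mul_le_mul_of_nonneg_right (by exact_mod_cast hcard) (hG s)

end Primes

section AveragedBump

open scoped FourierTransform

theorem integrable_fourierChar_smul {f : ℝ → ℂ} (hf : Integrable f) (ξ : ℝ) :
    Integrable fun x => 𝐞 (-(x * ξ)) • f x := by
  simpa [mul_comm] using (Real.fourierIntegral_convergent_iff ξ).2 hf

theorem hasSum_fourier_mul {f : ℝ → ℂ} (hf : Integrable f) {c : ℤ → ℂ}
    (hc : Summable fun m => ‖c m‖) {h : ℝ → ℂ}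
    (hh : ∀ y : ℝ, HasSum (fun m : ℤ => c m * (𝐞 (m * y) : ℂ)) (h y)) (q t ξ : ℝ) :
    HasSum (fun m : ℤ => c m * (𝐞 (m * t) : ℂ) * 𝓕 f (ξ - m * q))
      (𝓕 (fun x => f x * h (q * x + t)) ξ) := by
  set F : ℤ → ℝ → ℂ := fun m x => c m * (𝐞 (m * t) : ℂ) * (𝐞 (-(x * (ξ - m * q))) • f x)
  have hF_int (m : ℤ) : Integrable (F m) :=
    (integrable_fourierChar_smul hf (ξ - m * q)).const_mul _
  have hF_norm (m : ℤ) (x : ℝ) : ‖F m x‖ = ‖c m‖ * ‖f x‖ := by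
    simp only [F, norm_mul, Circle.norm_coe, Circle.norm_smul, mul_one]
  have hF_summable : Summable fun m => ∫ x, ‖F m x‖ := by
    simp_rw [hF_norm, integral_const_mul]
    exact hc.mul_right _
  have hF_sum (x : ℝ) : HasSum (fun m => F m x) (𝐞 (-(x * ξ)) • (f x * h (q * x + t))) := by
    have hx := (hh (q * x + t)).mul_left ((𝐞 (-(x * ξ)) : ℂ) * f x)
    rw [Circle.smul_def, smul_eq_mul, ← mul_assoc]
    refine hx.congr_fun fun m => ?_
    have hchar : (𝐞 (m * t) : ℂ) * (𝐞 (-(x * (ξ - m * q))) : ℂ) =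
        (𝐞 (-(x * ξ)) : ℂ) * (𝐞 (m * (q * x + t)) : ℂ) := by
      rw [← Circle.coe_mul, ← Circle.coe_mul, ← AddChar.map_add_eq_mul,
        ← AddChar.map_add_eq_mul]
      congr 2
      ring
    simp only [F, Circle.smul_def, smul_eq_mul]
    linear_combination c m * f x * hchar
  have hterm (m : ℤ) : ∫ x, F m x = c m * (𝐞 (m * t) : ℂ) * 𝓕 f (ξ - m * q) := by
    rw [integral_const_mul, Real.fourier_real_eq]
  have hlim : ∫ x, ∑' m, F m x = 𝓕 (fun x => f x * h (q * x + t)) ξ := by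
    rw [Real.fourier_real_eq]
    exact integral_congr_ae (.of_forall fun x => (hF_sum x).tsum_eq)
  simpa only [hterm, hlim] using hasSum_integral_of_summable_integral_norm hF_int hF_summable

/-- The mean over `q ∈ P` of the `1 / q`-periodic bumps concentrated at the points `x` for which
`q * x + t q` is within `w q` of an integer. -/
noncomputable def averagedBump (P : Finset ℕ) (w t : ℕ → ℝ) (x : ℝ) : ℝ :=
  (P.card : ℝ)⁻¹ * ∑ q ∈ P, periodicBump (w q) (q * x + t q)

variable {P : Finset ℕ} {w t : ℕ → ℝ}

theorem averagedBump_nonneg (hw : ∀ q ∈ P, 0 < w q) (x : ℝ) : 0 ≤ averagedBump P w t x :=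
  mul_nonneg (by positivity) (Finset.sum_nonneg fun q hq => periodicBump_nonneg (hw q hq) _)

theorem continuous_averagedBump (hw : ∀ q ∈ P, 0 < w q) : Continuous (averagedBump P w t) :=
  continuous_const.mul <| continuous_finsetSum _ fun q hq =>
    (continuous_periodicBump (hw q hq)).comp (by fun_prop)

theorem exists_mem_abs_sub_intCast_le_of_averagedBump_ne_zero (hw : ∀ q ∈ P, 0 < w q) {x : ℝ}
    (hx : averagedBump P w t x ≠ 0) : ∃ q ∈ P, ∃ n : ℤ, |q * x + t q - n| ≤ w q := by
  obtain ⟨q, hq, hne⟩ := Finset.exists_ne_zero_of_sum_ne_zero (right_ne_zero_of_mul hx)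
  exact ⟨q, hq, exists_abs_sub_intCast_le_of_periodicBump_ne_zero (hw q hq) hne⟩

variable {f : ℝ → ℂ}

theorem integrable_mul_periodicBump (hf : Integrable f) {v : ℝ} (hv : 0 < v) (q s : ℝ) :
    Integrable fun x => f x * (periodicBump v (q * x + s) : ℂ) := by
  have hmeas : Continuous fun x : ℝ => (periodicBump v (q * x + s) : ℂ) :=
    Complex.continuous_ofReal.comp ((continuous_periodicBump hv).comp (by fun_prop))
  refine hf.mul_bdd hmeas.aestronglyMeasurable
    (c := ∑' m : ℤ, ‖𝓕 (fun x => (unitBump x : ℂ)) (v * m)‖) (.of_forall fun x => ?_)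
  rw [← (hasSum_periodicBump hv _).tsum_eq]
  refine tsum_of_norm_bounded (summable_norm_fourier_unitBump hv).hasSum fun m => ?_
  rw [norm_mul, Circle.norm_coe, mul_one]

theorem fourier_mul_averagedBump (hf : Integrable f) (hw : ∀ q ∈ P, 0 < w q) (ξ : ℝ) :
    𝓕 (fun x => f x * (averagedBump P w t x : ℂ)) ξ = (P.card : ℂ)⁻¹ *
      ∑ q ∈ P, 𝓕 (fun x => f x * (periodicBump (w q) (q * x + t q) : ℂ)) ξ := by
  simp only [Real.fourier_real_eq]
  rw [← integral_finsetSum _ fun q hq => integrable_fourierChar_smul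
    (integrable_mul_periodicBump hf (hw q hq) q (t q)) ξ, ← integral_const_mul]
  refine integral_congr_ae (.of_forall fun x => ?_)
  simp only [averagedBump, Circle.smul_def, smul_eq_mul, Complex.ofReal_mul, Complex.ofReal_inv,
    Complex.ofReal_natCast, Complex.ofReal_sum, Finset.mul_sum]
  exact Finset.sum_congr rfl fun q _ => by ring

/-- The contribution of the frequency `m * q` to the Fourier transform at `ξ` of the product of
`f` with the bump of denominator `q` in `averagedBump P w t`. -/
noncomputable def bumpTerm (f : ℝ → ℂ) (w t : ℕ → ℝ) (ξ : ℝ) (q : ℕ) (m : ℤ) : ℂ :=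
  𝓕 (fun x => (unitBump x : ℂ)) (w q * m) * (𝐞 (m * t q) : ℂ) * 𝓕 f (ξ - m * q)

theorem hasSum_fourier_mul_averagedBump_sub (hf : Integrable f) (hP : P.Nonempty)
    (hw : ∀ q ∈ P, 0 < w q) (ξ : ℝ) :
    HasSum (fun m : ℤ => if m = 0 then 0 else (P.card : ℂ)⁻¹ * ∑ q ∈ P, bumpTerm f w t ξ q m)
      (𝓕 (fun x => f x * (averagedBump P w t x : ℂ)) ξ - 𝓕 f ξ) := by
  have hcard : (P.card : ℂ) ≠ 0 := by exact_mod_cast hP.card_ne_zero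
  have hsum : HasSum (fun m : ℤ => (P.card : ℂ)⁻¹ * ∑ q ∈ P, bumpTerm f w t ξ q m)
      (𝓕 (fun x => f x * (averagedBump P w t x : ℂ)) ξ) := by
    rw [fourier_mul_averagedBump hf hw]
    exact (hasSum_sum fun q hq => hasSum_fourier_mul hf (summable_norm_fourier_unitBump (hw q hq))
      (hasSum_periodicBump (hw q hq)) q (t q) ξ).mul_left _
  have hzero : (P.card : ℂ)⁻¹ * ∑ q ∈ P, bumpTerm f w t ξ q 0 = 𝓕 f ξ := by
    simp [bumpTerm, fourier_unitBump_zero, hcard]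
  refine (hsum.sub (hasSum_ite_eq (0 : ℤ) (𝓕 f ξ))).congr_fun fun m => ?_
  rcases eq_or_ne m 0 with rfl | hm
  · simp [hzero]
  · simp [hm]

theorem norm_bumpTerm_le {C B a m M : ℝ} (hC₀ : 0 ≤ C) (hM : 0 < M)
    (hC : ∀ s : ℝ, ‖𝓕 (fun x => (unitBump x : ℂ)) s‖ ≤ C / (1 + |s|) ^ 7)
    (hB : ∀ ξ, ‖𝓕 f ξ‖ ≤ B * decayWeight a m ξ) {q : ℕ} (hw : (q : ℝ) / M ≤ w q) (ξ : ℝ)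
    (k : ℤ) :
    ‖bumpTerm f w t ξ q k‖ ≤ C / (1 + |((k * q : ℤ) : ℝ)| / M) ^ 7 *
      (B * decayWeight a m (ξ - (k * q : ℤ))) := by
  have hfreq : |((k * q : ℤ) : ℝ)| / M ≤ |w q * k| := by
    push_cast
    rw [abs_mul, abs_mul, Nat.abs_cast, mul_comm, mul_div_right_comm]
    gcongr
    exact hw.trans (le_abs_self _)
  rw [bumpTerm, norm_mul, norm_mul, Circle.norm_coe, mul_one]
  refine mul_le_mul ((hC _).trans ?_) ?_ (norm_nonneg _) (by positivity)
  · gcongr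
  · exact_mod_cast hB (ξ - k * q)

theorem sum_sum_inv_pow_mul_decayWeight_le {D a m M : ℝ} (hP₀ : ∀ q ∈ P, q ≠ 0) (hD : 0 ≤ D)
    (ha₀ : 0 ≤ a) (ha₁ : a < 1) (hm : 1 ≤ m) (hmM : m ^ 2 ≤ M)
    (hdvd : ∀ s : ℤ, s ≠ 0 →
      (({q ∈ P | (q : ℤ) ∣ s} : Finset ℕ).card : ℝ) ≤ D * (1 + |(s : ℝ)| / M))
    (ξ : ℝ) {S : Finset ℤ} (hS : (0 : ℤ) ∉ S) :
    ∑ k ∈ S, ∑ q ∈ P, ((1 + |((k * q : ℤ) : ℝ)| / M) ^ 7)⁻¹ * decayWeight a m (ξ - (k * q : ℤ)) ≤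
      D * (32 / (1 - a) * M ^ a * m ^ (1 - a) * decayWeight a M ξ) := by
  have hM : 0 < M := by nlinarith
  set G : ℤ → ℝ := fun s => ((1 + |(s : ℝ)| / M) ^ 7)⁻¹ * decayWeight a m (ξ - s)
  have hG (s : ℤ) : 0 ≤ G s := mul_nonneg (by positivity) (decayWeight_nonneg (by linarith) _)
  refine (sum_sum_mul_le_sum_card_dvd_mul hG S hP₀).trans <| le_trans ?_ <|
    mul_le_mul_of_nonneg_left (sum_inv_pow_mul_decayWeight_le ha₀ ha₁ hm hmM ξ
      ((S ×ˢ P).image fun x => x.1 * (x.2 : ℤ))) hD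
  rw [Finset.mul_sum]
  refine Finset.sum_le_sum fun s hs => ?_
  obtain ⟨x, hx, rfl⟩ := Finset.mem_image.1 hs
  obtain ⟨hxS, hxP⟩ := Finset.mem_product.1 hx
  have hs₀ : x.1 * (x.2 : ℤ) ≠ 0 :=
    mul_ne_zero (fun h => hS (h ▸ hxS)) (by exact_mod_cast hP₀ _ hxP)
  refine (mul_le_mul_of_nonneg_right (hdvd _ hs₀) (hG _)).trans_eq ?_
  simp only [G]
  field_simp

theorem norm_fourier_mul_averagedBump_sub_le {C D B a m M : ℝ} (hf : Integrable f)
    (hP : P.Nonempty) (hP₀ : ∀ q ∈ P, q ≠ 0) (hC₀ : 0 ≤ C) (hD : 0 ≤ D) (hB₀ : 0 ≤ B)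
    (ha₀ : 0 ≤ a) (ha₁ : a < 1) (hm : 1 ≤ m) (hmM : m ^ 2 ≤ M)
    (hC : ∀ s : ℝ, ‖𝓕 (fun x => (unitBump x : ℂ)) s‖ ≤ C / (1 + |s|) ^ 7)
    (hB : ∀ ξ, ‖𝓕 f ξ‖ ≤ B * decayWeight a m ξ) (hw : ∀ q ∈ P, (q : ℝ) / M ≤ w q)
    (hdvd : ∀ s : ℤ, s ≠ 0 →
      (({q ∈ P | (q : ℤ) ∣ s} : Finset ℕ).card : ℝ) ≤ D * (1 + |(s : ℝ)| / M)) (ξ : ℝ) :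
    ‖𝓕 (fun x => f x * (averagedBump P w t x : ℂ)) ξ - 𝓕 f ξ‖ ≤
      (P.card : ℝ)⁻¹ * (C * D * B) * (32 / (1 - a) * M ^ a * m ^ (1 - a)) *
        decayWeight a M ξ := by
  have hM : 0 < M := by nlinarith
  have hw₀ : ∀ q ∈ P, 0 < w q := fun q hq =>
    (div_pos (by exact_mod_cast (hP₀ q hq).bot_lt) hM).trans_le (hw q hq)
  have herase (S : Finset ℤ) :
      ∑ k ∈ S, (if k = 0 then 0 else (P.card : ℂ)⁻¹ * ∑ q ∈ P, bumpTerm f w t ξ q k) =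
        (P.card : ℂ)⁻¹ * ∑ k ∈ S.erase 0, ∑ q ∈ P, bumpTerm f w t ξ q k := by
    rw [Finset.sum_ite, Finset.sum_const_zero, zero_add, Finset.filter_ne', Finset.mul_sum]
  refine le_of_tendsto' (hasSum_fourier_mul_averagedBump_sub hf hP hw₀ ξ).norm fun S => ?_
  rw [herase, norm_mul, norm_inv, Complex.norm_natCast]
  calc (P.card : ℝ)⁻¹ * ‖∑ k ∈ S.erase 0, ∑ q ∈ P, bumpTerm f w t ξ q k‖
      ≤ (P.card : ℝ)⁻¹ * ∑ k ∈ S.erase 0, ∑ q ∈ P, C / (1 + |((k * q : ℤ) : ℝ)| / M) ^ 7 *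
          (B * decayWeight a m (ξ - (k * q : ℤ))) := by
        gcongr
        exact norm_sum_le_of_le _ fun k _ => norm_sum_le_of_le _ fun q hq =>
          norm_bumpTerm_le hC₀ hM hC hB (hw q hq) ξ k
    _ = (P.card : ℝ)⁻¹ * (C * B) * ∑ k ∈ S.erase 0, ∑ q ∈ P,
          ((1 + |((k * q : ℤ) : ℝ)| / M) ^ 7)⁻¹ * decayWeight a m (ξ - (k * q : ℤ)) := by
        simp only [Finset.mul_sum]
        exact Finset.sum_congr rfl fun k _ => Finset.sum_congr rfl fun q _ => by ring
    _ ≤ (P.card : ℝ)⁻¹ * (C * B) *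
          (D * (32 / (1 - a) * M ^ a * m ^ (1 - a) * decayWeight a M ξ)) := by
        gcongr
        exact sum_sum_inv_pow_mul_decayWeight_le hP₀ hD ha₀ ha₁ hm hmM hdvd ξ
          (Finset.notMem_erase 0 S)
    _ = _ := by ring

end AveragedBump

section WeakLimits

theorem exists_subseq_tendsto_of_measure_compl_eq_zero {E : Type*} [MeasurableSpace E]
    [MetricSpace E] [SecondCountableTopology E] [BorelSpace E] (ν : ℕ → ProbabilityMeasure E)
    {K : Set E} (hK : IsCompact K) (hν : ∀ k, (ν k : Measure E) Kᶜ = 0) :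
    ∃ (μ : ProbabilityMeasure E) (n : ℕ → ℕ), StrictMono n ∧ Tendsto (ν ∘ n) atTop (𝓝 μ) := by
  have htight : IsTightMeasureSet
      {((μ : ProbabilityMeasure E) : Measure E) | μ ∈ Set.range ν} := by
    rw [isTightMeasureSet_iff_exists_isCompact_measure_compl_le]
    rintro ε -
    refine ⟨K, hK, ?_⟩
    rintro _ ⟨_, ⟨k, rfl⟩, rfl⟩
    exact (hν k).trans_le zero_le
  obtain ⟨μ, -, n, hn, hμ⟩ := (isCompact_closure_of_isTightMeasureSet htight).tendsto_subseq
    fun k => subset_closure (Set.mem_range_self k)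
  exact ⟨μ, n, hn, hμ⟩

theorem measure_compl_eq_zero_of_tendsto {E : Type*} [MeasurableSpace E] [PseudoEMetricSpace E]
    [OpensMeasurableSpace E] {ι : Type*} {l : Filter ι} [l.NeBot] {ν : ι → ProbabilityMeasure E}
    {μ : ProbabilityMeasure E} (hμ : Tendsto ν l (𝓝 μ)) {K : Set E} (hK : IsClosed K)
    (hν : ∀ᶠ i in l, (ν i : Measure E) Kᶜ = 0) : (μ : Measure E) Kᶜ = 0 := by
  have h := ProbabilityMeasure.le_liminf_measure_open_of_tendsto hμ hK.isOpen_compl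
  rw [liminf_congr hν, liminf_const] at h
  exact le_antisymm h zero_le

theorem measureFourier_eq_charFun (μ : Measure ℝ) (ξ : ℝ) :
    measureFourier μ ξ = charFun μ (-(2 * Real.pi * ξ)) := by
  rw [measureFourier, charFun_apply_real]
  congr! 3 with x
  push_cast
  ring

theorem supportsFourierDecay_iInter {ν : ℕ → ProbabilityMeasure ℝ} {K : ℕ → Set ℝ} {C s : ℝ}
    (hK : ∀ k, IsCompact (K k)) (hK_anti : Antitone K)
    (hν : ∀ k, (ν k : Measure ℝ) (K k)ᶜ = 0)
    (hdecay : ∀ k ξ, ξ ≠ 0 → ‖measureFourier (ν k) ξ‖ ≤ C * |ξ| ^ (-s / 2)) :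
    SupportsFourierDecay (⋂ k, K k) s := by
  have hνK {j k : ℕ} (hjk : j ≤ k) : (ν k : Measure ℝ) (K j)ᶜ = 0 :=
    measure_mono_null (Set.compl_subset_compl.2 (hK_anti hjk)) (hν k)
  obtain ⟨μ, n, hn, hμ⟩ := exists_subseq_tendsto_of_measure_compl_eq_zero ν (hK 0)
    fun k => hνK k.zero_le
  refine ⟨μ, ⋂ k, K k, C, μ.2, (hK 0).of_isClosed_subset (isClosed_iInter fun k => (hK k).isClosed)
    (Set.iInter_subset K 0), subset_rfl, ?_, fun ξ hξ => ?_⟩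
  · rw [Set.compl_iInter, measure_iUnion_null_iff]
    refine fun j => measure_compl_eq_zero_of_tendsto hμ (hK j).isClosed ?_
    filter_upwards [hn.tendsto_atTop.eventually_ge_atTop j] with k hk using hνK hk
  · have hlim := ProbabilityMeasure.tendsto_iff_tendsto_charFun.1 hμ (-(2 * Real.pi * ξ))
    simp only [Function.comp_apply, ← measureFourier_eq_charFun] at hlim
    exact le_of_tendsto' hlim.norm fun k => hdecay (n k) ξ hξ

open scoped FourierTransform

variable {ρ : ℝ → ℝ}

theorem measureFourier_withDensity_ofReal (hρ : Measurable ρ) (hρ₀ : ∀ x, 0 ≤ ρ x) (ξ : ℝ) :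
    measureFourier (volume.withDensity fun x => ENNReal.ofReal (ρ x)) ξ =
      𝓕 (fun x => (ρ x : ℂ)) ξ := by
  rw [measureFourier, integral_withDensity_eq_integral_toReal_smul hρ.ennreal_ofReal
    (.of_forall fun x => ENNReal.ofReal_lt_top), Real.fourier_real_eq_integral_exp_smul]
  refine integral_congr_ae (.of_forall fun x => ?_)
  simp only [ENNReal.toReal_ofReal (hρ₀ x), Complex.real_smul, smul_eq_mul]
  rw [mul_comm]
  congr! 3
  push_cast
  ring

theorem isProbabilityMeasure_withDensity_ofReal (hρ : Integrable ρ) (hρ₀ : ∀ x, 0 ≤ ρ x)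
    (hmass : ∫ x, ρ x = 1) :
    IsProbabilityMeasure (volume.withDensity fun x => ENNReal.ofReal (ρ x)) := by
  constructor
  rw [withDensity_apply _ .univ, setLIntegral_univ,
    ← ofReal_integral_eq_lintegral_ofReal hρ (.of_forall hρ₀), hmass, ENNReal.ofReal_one]

theorem withDensity_ofReal_compl_eq_zero {K : Set ℝ} (hK : MeasurableSet K)
    (hρ : ∀ x, ρ x ≠ 0 → x ∈ K) :
    volume.withDensity (fun x => ENNReal.ofReal (ρ x)) Kᶜ = 0 := by
  rw [withDensity_apply _ hK.compl, setLIntegral_congr_fun hK.compl (g := fun _ => 0)]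
  · exact lintegral_zero
  · intro x hx
    simp [not_imp_comm.1 (hρ x) hx]

theorem supportsFourierDecay_iInter_of_density {ρ : ℕ → ℝ → ℝ} {K : ℕ → Set ℝ} {A c s : ℝ}
    (hc : 0 < c) (hρ : ∀ k, Continuous (ρ k)) (hρ₀ : ∀ k x, 0 ≤ ρ k x)
    (hK : ∀ k, IsCompact (K k)) (hK_anti : Antitone K) (hρK : ∀ k x, ρ k x ≠ 0 → x ∈ K k)
    (hmass : ∀ k, c ≤ ∫ x, ρ k x)
    (hdecay : ∀ k ξ, ξ ≠ 0 → ‖𝓕 (fun x => (ρ k x : ℂ)) ξ‖ ≤ A * |ξ| ^ (-s / 2)) :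
    SupportsFourierDecay (⋂ k, K k) s := by
  set I : ℕ → ℝ := fun k => ∫ x, ρ k x
  have hI (k : ℕ) : 0 < I k := hc.trans_le (hmass k)
  set σ : ℕ → ℝ → ℝ := fun k x => (I k)⁻¹ * ρ k x
  have hσ₀ (k : ℕ) (x : ℝ) : 0 ≤ σ k x := mul_nonneg (inv_nonneg.2 (hI k).le) (hρ₀ k x)
  have hρ_int (k : ℕ) : Integrable (ρ k) := (hρ k).integrable_of_hasCompactSupport
    (.of_support_subset_isCompact (hK k) fun x hx => hρK k x hx)
  have hσ_mass (k : ℕ) : ∫ x, σ k x = 1 := by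
    rw [integral_const_mul, inv_mul_cancel₀ (hI k).ne']
  have hσ_fourier (k : ℕ) (ξ : ℝ) :
      𝓕 (fun x => (σ k x : ℂ)) ξ = ((I k)⁻¹ : ℝ) * 𝓕 (fun x => (ρ k x : ℂ)) ξ := by
    simp only [σ, Complex.ofReal_mul, Real.fourier_real_eq, Circle.smul_def, smul_eq_mul,
      mul_left_comm _ (((I k)⁻¹ : ℝ) : ℂ), integral_const_mul]
  refine supportsFourierDecay_iInter (C := c⁻¹ * A) (ν := fun k => ⟨_,
    isProbabilityMeasure_withDensity_ofReal ((hρ_int k).const_mul _) (hσ₀ k) (hσ_mass k)⟩) hK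
    hK_anti (fun k => withDensity_ofReal_compl_eq_zero (hK k).measurableSet fun x hx =>
      hρK k x (right_ne_zero_of_mul hx)) fun k ξ hξ => ?_
  rw [ProbabilityMeasure.coe_mk, measureFourier_withDensity_ofReal
    ((hρ k).measurable.const_mul _) (hσ₀ k), hσ_fourier, norm_mul, Complex.norm_real,
    Real.norm_of_nonneg (inv_nonneg.2 (hI k).le), mul_assoc]
  exact mul_le_mul (inv_anti₀ hc (hmass k)) (hdecay k ξ hξ) (norm_nonneg _)
    (inv_nonneg.2 hc.le)

end WeakLimits

section InfiniteProducts

open scoped FourierTransform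

theorem norm_le_mul_of_norm_sub_le {X E : Type*} [SeminormedAddCommGroup E] {φ : ℕ → X → E}
    {W : ℕ → X → ℝ} {B : ℝ} (hB : 0 ≤ B) (hW₀ : ∀ k x, 0 ≤ W k x)
    (hW : ∀ k x, W k x ≤ W (k + 1) x) (hφ : ∀ x, ‖φ 0 x‖ ≤ B * W 0 x)
    (hstep : ∀ k, (∀ x, ‖φ k x‖ ≤ (B + 1) * W k x) →
      ∀ x, ‖φ (k + 1) x - φ k x‖ ≤ (1 / 2) ^ (k + 2) * W (k + 1) x) (k : ℕ) (x : X) :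
    ‖φ k x‖ ≤ (B + 1) * W k x := by
  have hsharp : ∀ k x, ‖φ k x‖ ≤ (B + 1 / 2 * (1 - (1 / 2) ^ k)) * W k x := by
    intro k
    induction k with
    | zero => simpa using hφ
    | succ k ih =>
      intro x
      have hpow : (1 / 2 : ℝ) ^ k ≤ 1 := pow_le_one₀ (by norm_num) (by norm_num)
      have hpow₀ : (0 : ℝ) ≤ (1 / 2) ^ k := by positivity
      have hdiff := hstep k (fun y => (ih y).trans
        (mul_le_mul_of_nonneg_right (by linarith) (hW₀ k y))) x
      calc ‖φ (k + 1) x‖ ≤ ‖φ k x‖ + ‖φ (k + 1) x - φ k x‖ := norm_le_norm_add_norm_sub' _ _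
        _ ≤ (B + 1 / 2 * (1 - (1 / 2) ^ k)) * W (k + 1) x + (1 / 2) ^ (k + 2) * W (k + 1) x :=
          add_le_add ((ih x).trans (mul_le_mul_of_nonneg_left (hW k x) (by linarith))) hdiff
        _ = _ := by ring
  refine (hsharp k x).trans (mul_le_mul_of_nonneg_right ?_ (hW₀ k x))
  have : (0 : ℝ) ≤ (1 / 2) ^ k := by positivity
  linarith

theorem norm_sub_le_half_of_norm_succ_sub_le {E : Type*} [SeminormedAddCommGroup E] {u : ℕ → E}
    (hu : ∀ k, ‖u (k + 1) - u k‖ ≤ (1 / 2) ^ (k + 2)) (k : ℕ) : ‖u k - u 0‖ ≤ 1 / 2 := by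
  have hsum : dist (u 0) (u k) ≤ ∑ i ∈ Finset.range k, (1 / 2 : ℝ) ^ i * (1 / 2) ^ 2 :=
    dist_le_range_sum_of_dist_le k fun {i} _ => by
      rw [dist_comm, dist_eq_norm, ← pow_add]
      exact hu i
  rw [dist_comm, dist_eq_norm] at hsum
  rw [← Finset.sum_mul, geom_sum_eq (by norm_num)] at hsum
  rw [show ((1 / 2 : ℝ) ^ k - 1) / (1 / 2 - 1) * (1 / 2) ^ 2 = 1 / 2 * (1 - (1 / 2) ^ k) by ring]
    at hsum
  have : (0 : ℝ) ≤ (1 / 2) ^ k := by positivity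
  linarith

theorem iInter_inter_biInter_range {X : Type*} (K : Set X) (E : ℕ → Set X) :
    ⋂ k, (K ∩ ⋂ j ∈ Finset.range k, E j) = K ∩ ⋂ k, E k := by
  ext x
  simp only [Set.mem_iInter, Set.mem_inter_iff]
  exact ⟨fun h => ⟨(h 0).1, fun k => (h (k + 1)).2 k (Finset.self_mem_range_succ k)⟩,
    fun h k => ⟨h.1, fun j _ => h.2 j⟩⟩

/-- The `k`-th approximation `ρ * F 0 * ⋯ * F (k - 1)` to the infinite product of the density `ρ`
with the multipliers `F j`. -/
def partialProduct (ρ : ℝ → ℝ) (F : ℕ → ℝ → ℝ) (k : ℕ) (x : ℝ) : ℝ :=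
  ρ x * ∏ j ∈ Finset.range k, F j x

variable {ρ : ℝ → ℝ} {F : ℕ → ℝ → ℝ}

theorem partialProduct_succ (k : ℕ) (x : ℝ) :
    partialProduct ρ F (k + 1) x = partialProduct ρ F k x * F k x := by
  simp only [partialProduct, Finset.prod_range_succ, mul_assoc]

theorem continuous_partialProduct (hρ : Continuous ρ) (hF : ∀ k, Continuous (F k)) (k : ℕ) :
    Continuous (partialProduct ρ F k) :=
  hρ.mul (continuous_finsetProd _ fun j _ => hF j)

theorem partialProduct_nonneg (hρ : ∀ x, 0 ≤ ρ x) (hF : ∀ k x, 0 ≤ F k x) (k : ℕ) (x : ℝ) :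
    0 ≤ partialProduct ρ F k x :=
  mul_nonneg (hρ x) (Finset.prod_nonneg fun j _ => hF j x)

theorem mem_of_partialProduct_ne_zero {K : Set ℝ} {E : ℕ → Set ℝ} (hρ : ∀ x, ρ x ≠ 0 → x ∈ K)
    (hF : ∀ k x, F k x ≠ 0 → x ∈ E k) {k : ℕ} {x : ℝ} (hx : partialProduct ρ F k x ≠ 0) :
    x ∈ K ∩ ⋂ j ∈ Finset.range k, E j :=
  ⟨hρ x (left_ne_zero_of_mul hx), Set.mem_iInter₂.2 fun j hj =>
    hF j x (Finset.prod_ne_zero_iff.1 (right_ne_zero_of_mul hx) j hj)⟩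

theorem supportsFourierDecay_of_multipliers {K : Set ℝ} {E : ℕ → Set ℝ} {m : ℕ → ℝ} {a B : ℝ}
    (ha : 0 ≤ a) (hB : 0 ≤ B) (hm₀ : ∀ k, 0 < m k) (hm : ∀ k, m k ≤ m (k + 1))
    (hρ : Continuous ρ) (hρ₀ : ∀ x, 0 ≤ ρ x) (hρ_mass : ∫ x, ρ x = 1) (hK : IsCompact K)
    (hρK : ∀ x, ρ x ≠ 0 → x ∈ K)
    (hρ_fourier : ∀ ξ, ‖𝓕 (fun x => (ρ x : ℂ)) ξ‖ ≤ B * decayWeight a (m 0) ξ)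
    (hF : ∀ k, Continuous (F k)) (hF₀ : ∀ k x, 0 ≤ F k x) (hE : ∀ k, IsClosed (E k))
    (hFE : ∀ k x, F k x ≠ 0 → x ∈ E k)
    (hstep : ∀ (k : ℕ) (f : ℝ → ℂ), Integrable f →
      (∀ ξ, ‖𝓕 f ξ‖ ≤ (B + 1) * decayWeight a (m k) ξ) →
      ∀ ξ, ‖𝓕 (fun x => f x * (F k x : ℂ)) ξ - 𝓕 f ξ‖ ≤
        (1 / 2) ^ (k + 2) * decayWeight a (m (k + 1)) ξ) :
    SupportsFourierDecay (K ∩ ⋂ k, E k) (2 * a) := by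
  set L : ℕ → Set ℝ := fun k => K ∩ ⋂ j ∈ Finset.range k, E j
  have hL (k : ℕ) : IsCompact (L k) := hK.inter_right (isClosed_biInter fun j _ => hE j)
  have hL_anti : Antitone L := fun i j hij =>
    Set.inter_subset_inter_right K (Set.biInter_mono (Finset.range_mono hij) fun _ _ => subset_rfl)
  have hcont := continuous_partialProduct hρ hF
  have hsupp (k : ℕ) (x : ℝ) (hx : partialProduct ρ F k x ≠ 0) : x ∈ L k :=
    mem_of_partialProduct_ne_zero hρK hFE hx
  set φ : ℕ → ℝ → ℂ := fun k => 𝓕 (fun x => (partialProduct ρ F k x : ℂ))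
  have hφ_zero (k : ℕ) : φ k 0 = (∫ x, partialProduct ρ F k x : ℝ) := fourier_ofReal_zero _
  have hφ_step (k : ℕ) (hk : ∀ ξ, ‖φ k ξ‖ ≤ (B + 1) * decayWeight a (m k) ξ) (ξ : ℝ) :
      ‖φ (k + 1) ξ - φ k ξ‖ ≤ (1 / 2) ^ (k + 2) * decayWeight a (m (k + 1)) ξ := by
    simp only [φ, partialProduct_succ, Complex.ofReal_mul]
    exact hstep k _ ((hcont k).integrable_of_hasCompactSupport
      (.of_support_subset_isCompact (hL k) (hsupp k))).ofReal hk ξ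
  have hφ : ∀ k ξ, ‖φ k ξ‖ ≤ (B + 1) * decayWeight a (m k) ξ :=
    norm_le_mul_of_norm_sub_le hB (fun k => decayWeight_nonneg (hm₀ k).le)
      (fun k => decayWeight_mono_scale (hm₀ k) (hm k))
      (by simpa only [φ, partialProduct, Finset.range_zero, Finset.prod_empty, mul_one]) hφ_step
  have hmass (k : ℕ) : 1 / 2 ≤ ∫ x, partialProduct ρ F k x := by
    have hk := norm_sub_le_half_of_norm_succ_sub_le (u := fun k => φ k 0)
      (fun k => by simpa only [decayWeight_zero_right, mul_one] using hφ_step k (hφ k) 0) k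
    simp only [hφ_zero, ← Complex.ofReal_sub, Complex.norm_real, Real.norm_eq_abs] at hk
    simp only [partialProduct, Finset.range_zero, Finset.prod_empty, mul_one, hρ_mass] at hk ⊢
    linarith [(abs_le.1 hk).1]
  rw [← iInter_inter_biInter_range]
  refine supportsFourierDecay_iInter_of_density (A := B + 1) one_half_pos hcont
    (partialProduct_nonneg hρ₀ hF₀) hL hL_anti hsupp hmass fun k ξ hξ => (hφ k ξ).trans ?_
  rw [show -(2 * a) / 2 = -a by ring]
  exact mul_le_mul_of_nonneg_left (decayWeight_le_rpow ha (hm₀ k).le hξ) (by linarith)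

end InfiniteProducts

section Separation

theorem eventually_lt_rpow {p : ℝ} (hp : 0 < p) (A : ℝ) : ∀ᶠ N : ℝ in atTop, A < N ^ p :=
  (tendsto_rpow_atTop hp).eventually (eventually_gt_atTop A)

theorem eventually_two_mul_rpow_lt_mul_rpow {c s p : ℝ} (hc : 0 < c) (h : s < p) :
    ∀ᶠ N : ℝ in atTop, 2 * N ^ s < c * N ^ p := by
  filter_upwards [eventually_lt_rpow (sub_pos.2 h) (2 / c), eventually_gt_atTop 0] with N hN hN₀
  rw [div_lt_iff₀ hc, Real.rpow_sub hN₀, div_mul_eq_mul_div, lt_div_iff₀ (by positivity)] at hN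
  linarith

theorem exists_pos_le_of_finite {α : Type*} {S : Set α} (hS : S.Finite) {f : α → ℝ}
    (hf : ∀ x ∈ S, 0 < f x) : ∃ c : ℝ, 0 < c ∧ ∀ x ∈ S, c ≤ f x := by
  have hsmall : ∀ᶠ c in 𝓝[>] (0 : ℝ), ∀ x ∈ S, c ≤ f x :=
    (eventually_all_finite hS).2 fun x hx => nhdsWithin_le_nhds (eventually_le_nhds (hf x hx))
  obtain ⟨c, hc, hc₀⟩ := (hsmall.and self_mem_nhdsWithin).exists
  exact ⟨c, hc₀, hc⟩

theorem one_le_of_hasDiophantineExponent {θ γ : ℝ} (h : HasDiophantineExponent θ γ) : 1 ≤ γ := by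
  refine h.2 fun g hg => ?_
  by_contra! hlt
  -- Rounding `q θ` solves the inequality with exponent `1`, for every denominator `q`.
  refine Set.infinite_of_injective_forall_mem
    (f := fun n : ℕ => (round (((n + 1 : ℕ) : ℝ) * θ), n + 1))
    (fun a b hab => by simpa using (Prod.ext_iff.1 hab).2) (fun n => ?_) hg
  refine ⟨n.succ_pos, ?_⟩
  change |θ - (round (((n + 1 : ℕ) : ℝ) * θ) : ℝ) / ((n + 1 : ℕ) : ℝ)| ≤ ((n + 1 : ℕ) : ℝ) ^ (-g)
  have hn : (1 : ℝ) ≤ ((n + 1 : ℕ) : ℝ) := by exact_mod_cast Nat.le_add_left 1 n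
  generalize ((n + 1 : ℕ) : ℝ) = q at hn ⊢
  have hq : 0 < q := by linarith
  calc |θ - round (q * θ) / q| = |q * θ - round (q * θ)| / q := by
        rw [← abs_of_pos hq, ← abs_div, abs_of_pos hq]
        field_simp
    _ ≤ 1 / q := by gcongr; linarith [abs_sub_round (q * θ)]
    _ = q ^ (-1 : ℝ) := by rw [Real.rpow_neg_one, one_div]
    _ ≤ q ^ (-g) := Real.rpow_le_rpow_of_exponent_le hn (by linarith)

theorem exists_mul_rpow_neg_le_abs_sub_div {θ γ g : ℝ} (hθ : Irrational θ)
    (h : HasDiophantineExponent θ γ) (hg : γ < g) :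
    ∃ c : ℝ, 0 < c ∧ ∀ (p : ℤ) (n : ℕ), 0 < n → c * (n : ℝ) ^ (-g) ≤ |θ - p / n| := by
  obtain ⟨g', hg', hlt⟩ := (isGLB_lt_iff h).1 hg
  have hpos (x : ℤ × ℕ) : 0 < |θ - (x.1 : ℝ) / (x.2 : ℝ)| := by
    rw [abs_pos, sub_ne_zero]
    exact_mod_cast hθ.ne_rat ((x.1 : ℚ) / (x.2 : ℚ))
  obtain ⟨c, hc, hcS⟩ := exists_pos_le_of_finite hg' fun x _ => hpos x
  refine ⟨min c 1, lt_min hc one_pos, fun p n hn => ?_⟩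
  have hn₁ : (1 : ℝ) ≤ n := by exact_mod_cast hn
  by_cases hmem : |θ - (p : ℝ) / (n : ℝ)| ≤ (n : ℝ) ^ (-g')
  · have hg₁ := one_le_of_hasDiophantineExponent h
    calc min c 1 * (n : ℝ) ^ (-g) ≤ c * 1 := by
          gcongr
          · exact min_le_left _ _
          · exact Real.rpow_le_one_of_one_le_of_nonpos hn₁ (by linarith)
      _ ≤ |θ - p / n| := by simpa only [mul_one] using hcS (p, n) ⟨hn, hmem⟩
  · calc min c 1 * (n : ℝ) ^ (-g) ≤ 1 * (n : ℝ) ^ (-g') := by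
          gcongr
          exact min_le_right _ _
      _ ≤ |θ - p / n| := by linarith

/-- Distinct reduced fractions with numerators shifted by `θ` repel each other with exponent `g`:
`(r - θ) / q` and `(r' - θ) / q'`, where `q ≤ q'`, are `c * q' ^ (-g) / q` apart for some `c > 0`.
This is the only arithmetic property of `θ` that matters for the tightness of approximations. -/
def ShiftedFractionsSeparated (θ g : ℝ) : Prop :=
  ∃ c : ℝ, 0 < c ∧ ∀ (r r' : ℤ) (q q' : ℕ), 0 < q → q ≤ q' → IsCoprime r (q : ℤ) →
    IsCoprime r' (q' : ℤ) → (r, q) ≠ (r', q') →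
    c * (q' : ℝ) ^ (-g) / q ≤ |((r : ℝ) - θ) / q - ((r' : ℝ) - θ) / q'|

theorem one_div_mul_le_abs_div_sub_div {r r' : ℤ} {q q' : ℕ} (hq : 0 < q) (hq' : 0 < q')
    (hr : IsCoprime r (q : ℤ)) (hr' : IsCoprime r' (q' : ℤ)) (hne : (r, q) ≠ (r', q')) :
    1 / ((q : ℝ) * q') ≤ |(r : ℝ) / q - (r' : ℝ) / q'| := by
  have hq₀ : (0 : ℝ) < q := by exact_mod_cast hq
  have hq'₀ : (0 : ℝ) < q' := by exact_mod_cast hq'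
  have hcross : r * q' - q * r' ≠ 0 := fun h => hne <| by
    have hrat : (r : ℚ) / (q : ℤ) = (r' : ℚ) / (q' : ℤ) := by
      rw [div_eq_div_iff (by positivity) (by positivity), mul_comm (r' : ℚ)]
      exact_mod_cast sub_eq_zero.1 h
    obtain ⟨hr_eq, hq_eq⟩ := Rat.div_int_inj (by exact_mod_cast hq) (by exact_mod_cast hq')
      (Int.isCoprime_iff_gcd_eq_one.1 hr) (Int.isCoprime_iff_gcd_eq_one.1 hr') hrat
    exact Prod.ext hr_eq (by exact_mod_cast hq_eq)
  rw [div_sub_div _ _ hq₀.ne' hq'₀.ne', abs_div, abs_of_pos (mul_pos hq₀ hq'₀)]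
  gcongr
  exact_mod_cast Int.one_le_abs hcross

theorem shiftedFractionsSeparated_zero {g : ℝ} (hg : 1 ≤ g) : ShiftedFractionsSeparated 0 g := by
  refine ⟨1, one_pos, fun r r' q q' hq hqq' hr hr' hne => ?_⟩
  have : (0 : ℝ) < q := by exact_mod_cast hq
  have hq' : (1 : ℝ) ≤ q' := by exact_mod_cast hq.trans_le hqq'
  simp only [sub_zero]
  calc 1 * (q' : ℝ) ^ (-g) / q ≤ 1 * (q' : ℝ) ^ (-1 : ℝ) / q := by gcongr
    _ = 1 / (q * q') := by rw [Real.rpow_neg_one]; field_simp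
    _ ≤ _ := one_div_mul_le_abs_div_sub_div hq (hq.trans_le hqq') hr hr' hne

theorem one_div_le_abs_sub_div_sub_sub_div {r r' : ℤ} (hne : r ≠ r') (θ : ℝ) (q : ℕ) :
    1 / (q : ℝ) ≤ |((r : ℝ) - θ) / q - ((r' : ℝ) - θ) / q| := by
  rw [← sub_div, sub_sub_sub_cancel_right, abs_div, Nat.abs_cast]
  gcongr
  exact_mod_cast Int.one_le_abs (sub_ne_zero.2 hne)

theorem mul_rpow_neg_div_le_abs_sub_of_lt {θ c g : ℝ} (hc : 0 < c) (hg : 1 ≤ g)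
    (hθ : ∀ (p : ℤ) (n : ℕ), 0 < n → c * (n : ℝ) ^ (-g) ≤ |θ - p / n|) (r r' : ℤ) {q q' : ℕ}
    (hq : 0 < q) (hlt : q < q') :
    c * (q' : ℝ) ^ (-g) / q ≤ |((r : ℝ) - θ) / q - ((r' : ℝ) - θ) / q'| := by
  obtain ⟨n, rfl⟩ := Nat.exists_eq_add_of_le hlt.le
  have hn : 0 < n := by lia
  have : (0 : ℝ) < q := by exact_mod_cast hq
  have hn₀ : (0 : ℝ) < n := by exact_mod_cast hn
  set p : ℤ := r * (q + n : ℕ) - r' * q with hp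
  -- The two points differ by a multiple of `θ - p / n`.
  have hdiff : ((r : ℝ) - θ) / q - ((r' : ℝ) - θ) / ((q + n : ℕ) : ℝ) =
      -((θ - p / n) * (n / (q * ((q + n : ℕ) : ℝ)))) := by
    rw [hp]
    push_cast
    field_simp
    ring
  rw [hdiff, abs_neg, abs_mul, abs_of_pos (a := (n : ℝ) / _) (by positivity)]
  have hnq : (n : ℝ) ≤ ((q + n : ℕ) : ℝ) := by exact_mod_cast Nat.le_add_left n q
  generalize ((q + n : ℕ) : ℝ) = Q at hnq ⊢
  have hQ : 0 < Q := hn₀.trans_le hnq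
  calc c * Q ^ (-g) / q = c * Q ^ (1 - g) / (q * Q) := by
        rw [sub_eq_add_neg, Real.rpow_add hQ, Real.rpow_one]; field_simp
    _ ≤ c * (n : ℝ) ^ (1 - g) / (q * Q) := by
        have := Real.rpow_le_rpow_of_nonpos hn₀ hnq (by linarith : 1 - g ≤ 0)
        gcongr
    _ = c * (n : ℝ) ^ (-g) * (n / (q * Q)) := by
        rw [sub_eq_add_neg, Real.rpow_add hn₀, Real.rpow_one]; ring
    _ ≤ _ := by gcongr; exact hθ p n hn

theorem shiftedFractionsSeparated_of_irrational {θ γ g : ℝ} (hθ : Irrational θ)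
    (h : HasDiophantineExponent θ γ) (hg : γ < g) : ShiftedFractionsSeparated θ g := by
  have hg₁ : 1 ≤ g := (one_le_of_hasDiophantineExponent h).trans hg.le
  obtain ⟨c, hc, hcθ⟩ := exists_mul_rpow_neg_le_abs_sub_div hθ h hg
  refine ⟨min c 1, lt_min hc one_pos, fun r r' q q' hq hqq' _ _ hne => ?_⟩
  rcases hqq'.eq_or_lt with rfl | hlt
  · have hr : r ≠ r' := fun hr => hne (by rw [hr])
    refine le_trans ?_ (one_div_le_abs_sub_div_sub_sub_div hr θ q)
    have : (q : ℝ) ^ (-g) ≤ 1 :=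
      Real.rpow_le_one_of_one_le_of_nonpos (by exact_mod_cast hq) (by linarith)
    gcongr
    calc min c 1 * (q : ℝ) ^ (-g) ≤ 1 * 1 := by gcongr; exact min_le_right _ _
      _ = 1 := mul_one 1
  · refine le_trans ?_ (mul_rpow_neg_div_le_abs_sub_of_lt hc hg₁ hcθ r r' hq hlt)
    gcongr
    exact min_le_left _ _

theorem rpow_neg_add_rpow_neg_lt {c g σ u v : ℝ} (hu : 0 < u) (huv : u ≤ v) (hσ : 0 ≤ σ)
    (h : 2 * v ^ g < c * u ^ (σ - 1)) : u ^ (-σ) + v ^ (-σ) < c * v ^ (-g) / u := by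
  have hv : 0 < v := hu.trans_le huv
  have hvu : v ^ (-σ) ≤ u ^ (-σ) := Real.rpow_le_rpow_of_nonpos hu huv (by linarith)
  have hu_rpow : u ^ (-σ) = 1 / u ^ (σ - 1) / u := by
    rw [Real.rpow_neg hu.le, Real.rpow_sub hu, Real.rpow_one]
    field_simp
  calc u ^ (-σ) + v ^ (-σ) ≤ 2 * u ^ (-σ) := by linarith
    _ = 2 / u ^ (σ - 1) / u := by rw [hu_rpow]; ring
    _ < c / v ^ g / u := by
        gcongr ?_ / u
        rwa [div_lt_div_iff₀ (by positivity) (by positivity)]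
    _ = c * v ^ (-g) / u := by rw [Real.rpow_neg hv.le]; ring

/-- No fraction competes with a reduced one whose denominator lies in `(N ^ (1 - ε), N]`: the
`ψ`-neighbourhoods of two distinct reduced fractions shifted by `θ` are disjoint once the second
denominator lies in the window `[N ^ b⁻¹, N ^ b)`. -/
def WindowIsolated (ψ : ℕ → ℝ) (θ b ε N : ℝ) : Prop :=
  ∀ (r r' : ℤ) (q q' : ℕ), N ^ (1 - ε) < q → (q : ℝ) ≤ N → IsCoprime r (q : ℤ) →
    IsCoprime r' (q' : ℤ) → N ^ b⁻¹ ≤ q' → (q' : ℝ) < N ^ b → (r', q') ≠ (r, q) →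
    ψ q + ψ q' < |((r : ℝ) - θ) / q - ((r' : ℝ) - θ) / q'|

theorem eventually_windowIsolated {θ g σ b ε : ℝ} {ψ : ℕ → ℝ}
    (hθ : ShiftedFractionsSeparated θ g) (hg : 0 ≤ g) (hσ : 1 ≤ σ) (hb : 0 < b) (hε : 0 < ε)
    (hε₁ : ε < 1) (hbσ : b * g < (1 - ε) * (σ - 1))
    (hψ : ∀ᶠ q : ℕ in atTop, ψ q ≤ (q : ℝ) ^ (-σ)) :
    ∀ᶠ N : ℝ in atTop, WindowIsolated ψ θ b ε N := by
  obtain ⟨c, hc, hsep⟩ := hθ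
  obtain ⟨Q, hQ⟩ := eventually_atTop.1 hψ
  have hgσ : g < b⁻¹ * (σ - 1) := by
    rw [inv_mul_eq_div, lt_div_iff₀ hb, mul_comm]
    nlinarith
  filter_upwards [eventually_lt_rpow (sub_pos.2 hε₁) Q, eventually_lt_rpow (inv_pos.2 hb) Q,
    eventually_two_mul_rpow_lt_mul_rpow hc hbσ, eventually_two_mul_rpow_lt_mul_rpow hc hgσ,
    eventually_gt_atTop 0] with
    N hNQ hNQ' hN hN' hN₀ r r' q q' hqN hqN' hcop hcop' hq'N hq'N' hne
  have hq : (0 : ℝ) < q := lt_of_le_of_lt (by positivity) hqN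
  have hq' : (0 : ℝ) < q' := lt_of_lt_of_le (by positivity) hq'N
  refine (add_le_add (hQ q (by exact_mod_cast (hNQ.trans hqN).le))
    (hQ q' (by exact_mod_cast (hNQ'.trans_le hq'N).le))).trans_lt ?_
  rcases le_total q q' with hle | hle
  · refine (rpow_neg_add_rpow_neg_lt hq (by exact_mod_cast hle) (by linarith) ?_).trans_le
      (hsep r r' q q' (by exact_mod_cast hq) hle hcop hcop' hne.symm)
    calc 2 * (q' : ℝ) ^ g ≤ 2 * (N ^ b) ^ g := by gcongr
      _ = 2 * N ^ (b * g) := by rw [← Real.rpow_mul hN₀.le]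
      _ < c * N ^ ((1 - ε) * (σ - 1)) := hN
      _ = c * (N ^ (1 - ε)) ^ (σ - 1) := by rw [← Real.rpow_mul hN₀.le]
      _ ≤ c * (q : ℝ) ^ (σ - 1) := by gcongr
  · rw [add_comm, abs_sub_comm]
    refine (rpow_neg_add_rpow_neg_lt hq' (by exact_mod_cast hle) (by linarith) ?_).trans_le
      (hsep r' r q' q (by exact_mod_cast hq') hle hcop' hcop hne)
    calc 2 * (q : ℝ) ^ g ≤ 2 * N ^ g := by gcongr
      _ < c * N ^ (b⁻¹ * (σ - 1)) := hN'
      _ = c * (N ^ b⁻¹) ^ (σ - 1) := by rw [← Real.rpow_mul hN₀.le]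
      _ ≤ c * (q' : ℝ) ^ (σ - 1) := by gcongr

end Separation

section TightCriterion

variable {ψ₁ ψ₂ : ℕ → ℝ} {θ x : ℝ}

theorem finite_setOf_approx_lt (φ : ℕ → ℝ) (θ x X : ℝ) :
    {rq : ℤ × ℕ | 0 < rq.2 ∧ (rq.2 : ℝ) < X ∧
      |x - ((rq.1 : ℝ) - θ) / (rq.2 : ℝ)| ≤ φ rq.2}.Finite := by
  refine ((Finset.range ⌈X⌉₊).finite_toSet.biUnion fun q _ =>
    (Set.finite_Icc ⌈q * x + θ - q * φ q⌉ ⌊q * x + θ + q * φ q⌋).image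
      fun r : ℤ => (r, q)).subset ?_
  rintro ⟨r, q⟩ ⟨hq, hqX, h⟩
  have hq₀ : (0 : ℝ) < q := by exact_mod_cast hq
  refine Set.mem_iUnion₂.2 ⟨q, Finset.mem_range.2 (Nat.lt_ceil.2 hqX), r, ?_, rfl⟩
  have hx : x - ((r : ℝ) - θ) / q = (q * x + θ - r) / q := by field_simp; ring
  rw [hx, abs_div, abs_of_pos hq₀, div_le_iff₀ hq₀, abs_le] at h
  rw [Set.mem_Icc, Int.ceil_le, Int.le_floor]
  constructor <;> linarith [h.1, h.2]

theorem exists_ge_le_and_lt_succ {L : ℕ → ℝ} (hL : Tendsto L atTop atTop) {K : ℕ} {y : ℝ}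
    (hy : L K ≤ y) : ∃ k, K ≤ k ∧ L k ≤ y ∧ y < L (k + 1) := by
  by_contra! h
  have hle (k : ℕ) (hk : K ≤ k) : L k ≤ y := Nat.le_induction hy (fun k hk hky => h k hk hky) k hk
  obtain ⟨k, hk, hyk⟩ := ((eventually_ge_atTop K).and (hL.eventually_gt_atTop y)).exists
  exact (hle k hk).not_gt hyk

theorem infinite_approxPairs {φ : ℕ → ℝ} {r : ℕ → ℤ} {q : ℕ → ℕ} (hq : Tendsto q atTop atTop)
    (happrox : ∀ k, (r k, q k) ∈ approxPairs φ θ x) : (approxPairs φ θ x).Infinite := by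
  intro hfin
  obtain ⟨b, hb⟩ := (hfin.image Prod.snd).bddAbove
  obtain ⟨k, hk⟩ := (hq.eventually_gt_atTop b).exists
  exact (hb ⟨_, happrox k, rfl⟩).not_gt hk

theorem mem_tight_of_windows (hψ₂ : ∀ q, 1 ≤ q → 0 < ψ₂ q) {L κ : ℕ → ℝ}
    (hL : Tendsto L atTop atTop) (hκ : Tendsto κ atTop (𝓝 0)) {r : ℕ → ℤ} {q : ℕ → ℕ}
    (hq : Tendsto q atTop atTop) (happrox : ∀ k, (r k, q k) ∈ approxPairs ψ₁ θ x)
    (hlow : ∀ k, ψ₁ (q k) - κ k * ψ₂ (q k) ≤ |x - ((r k : ℝ) - θ) / q k|)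
    (hwindow : ∀ (k : ℕ) (r' : ℤ) (q' : ℕ), IsCoprime r' (q' : ℤ) → L k ≤ q' →
      (q' : ℝ) < L (k + 1) → (r', q') ≠ (r k, q k) →
      ψ₁ (q k) + ψ₁ q' < |((r k : ℝ) - θ) / q k - ((r' : ℝ) - θ) / q'|) :
    x ∈ Tight ψ₁ ψ₂ θ := by
  refine ⟨infinite_approxPairs hq happrox, fun c hc => ?_⟩
  obtain ⟨K, hK⟩ := eventually_atTop.1 (hκ.eventually_lt_const hc)
  refine (finite_setOf_approx_lt (fun q => ψ₁ q - c * ψ₂ q) θ x (L K)).subset ?_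
  rintro ⟨r', q'⟩ ⟨hq', hcop, h⟩
  refine ⟨hq', ?_, h⟩
  by_contra! hge
  obtain ⟨k, hKk, hLk, hLk'⟩ := exists_ge_le_and_lt_succ hL hge
  by_cases heq : (r', q') = (r k, q k)
  · obtain ⟨rfl, rfl⟩ := Prod.ext_iff.1 heq
    have := mul_lt_mul_of_pos_right (hK k hKk) (hψ₂ _ hq')
    linarith [hlow k, h]
  · have htriangle := abs_sub_le (((r k : ℝ) - θ) / q k) x (((r' : ℝ) - θ) / q')
    rw [abs_sub_comm _ x] at htriangle
    have := mul_pos hc (hψ₂ q' hq')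
    linarith [hwindow k r' q' hcop hLk hLk' heq, (happrox k).2.2, h]

theorem eventually_rpow_bounds_of_hasOrder {ψ : ℕ → ℝ} {τ ε : ℝ} (hψ : ∀ q, 1 ≤ q → 0 < ψ q)
    (h : HasOrder ψ τ) (hε : 0 < ε) :
    ∀ᶠ q : ℕ in atTop, (q : ℝ) ^ (-(τ + ε)) ≤ ψ q ∧ ψ q ≤ (q : ℝ) ^ (-(τ - ε)) := by
  filter_upwards [Metric.tendsto_nhds.1 h ε hε, eventually_ge_atTop 2] with q hq hq₂
  rw [Real.dist_eq, abs_lt] at hq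
  have hq₁ : (1 : ℝ) < q := by exact_mod_cast hq₂
  have hlog : 0 < Real.log q := Real.log_pos hq₁
  have hψq : ψ q = (q : ℝ) ^ (Real.log (ψ q) / Real.log q) := by
    rw [Real.rpow_def_of_pos (by linarith), mul_div_cancel₀ _ hlog.ne',
      Real.exp_log (hψ q (by lia))]
  constructor
  · exact (Real.rpow_le_rpow_of_exponent_le hq₁.le (by linarith)).trans_eq hψq.symm
  · exact hψq.trans_le (Real.rpow_le_rpow_of_exponent_le hq₁.le (by linarith))

theorem HasOrder.le_of_le {τ₁ τ₂ : ℝ} (h₁ : HasOrder ψ₁ τ₁) (h₂ : HasOrder ψ₂ τ₂)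
    (hpos : ∀ q : ℕ, 1 ≤ q → 0 < ψ₂ q) (hle : ∀ q : ℕ, 1 ≤ q → ψ₂ q ≤ ψ₁ q) : τ₁ ≤ τ₂ := by
  refine le_of_tendsto_of_tendsto h₁ h₂ ?_
  filter_upwards [eventually_ge_atTop 2] with q hq
  have : 0 < Real.log q := Real.log_pos (by exact_mod_cast hq)
  have := Real.log_le_log (hpos q (by lia)) (hle q (by lia))
  gcongr

end TightCriterion

section TightLayers

variable {ψ₁ ψ₂ : ℕ → ℝ} {θ κ x : ℝ} {P : Finset ℕ}

/-- The points `x` with `ψ₁ q - κ * ψ₂ q ≤ x - (n - θ) / q ≤ ψ₁ q` for some `q ∈ P` and `n : ℤ`: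
points approximated almost exactly to order `ψ₁` with a denominator in `P`. The inequalities are
multiplied by `q`, and `n` need not be coprime to `q`. -/
def tightLayer (ψ₁ ψ₂ : ℕ → ℝ) (θ : ℝ) (P : Finset ℕ) (κ : ℝ) : Set ℝ :=
  {x | ∃ q ∈ P, ∃ n : ℤ, q * x + θ - n ∈ Set.Icc (q * (ψ₁ q - κ * ψ₂ q)) (q * ψ₁ q)}

/-- The averaged bump adapted to `tightLayer`: each interval of the layer, rescaled by `q`, has
half-width `q * (κ * ψ₂ q) / 2` and its right end at `n - θ + q * ψ₁ q`. -/
noncomputable def tightMultiplier (ψ₁ ψ₂ : ℕ → ℝ) (θ : ℝ) (P : Finset ℕ) (κ : ℝ) : ℝ → ℝ :=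
  averagedBump P (fun q => q * (κ * ψ₂ q) / 2) fun q => θ - q * ψ₁ q + q * (κ * ψ₂ q) / 2

open scoped Pointwise in
theorem isClosed_tightLayer (ψ₁ ψ₂ : ℕ → ℝ) (θ : ℝ) (P : Finset ℕ) (κ : ℝ) :
    IsClosed (tightLayer ψ₁ ψ₂ θ P κ) := by
  have hunion : tightLayer ψ₁ ψ₂ θ P κ = ⋃ q ∈ P, (fun x : ℝ => q * x + θ) ⁻¹'
      (Set.range ((↑) : ℤ → ℝ) + Set.Icc (q * (ψ₁ q - κ * ψ₂ q)) (q * ψ₁ q)) := by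
    ext x
    simp only [tightLayer, Set.mem_ofPred_eq, Set.mem_iUnion, Set.mem_preimage, Set.mem_add,
      Set.mem_range, exists_exists_eq_and, exists_prop]
    refine exists_congr fun q => and_congr_right fun _ => exists_congr fun n => ?_
    exact ⟨fun h => ⟨_, h, by ring⟩, fun ⟨y, hy, hxy⟩ => by rwa [← hxy, add_sub_cancel_left]⟩
  rw [hunion]
  refine P.finite_toSet.isClosed_biUnion fun q _ => IsClosed.preimage (by fun_prop) ?_
  exact Int.isClosedEmbedding_coe_real.isClosed_range.add_right_of_isCompact isCompact_Icc

theorem mem_tightLayer_of_tightMultiplier_ne_zero (hψ₂ : ∀ q ∈ P, 0 < q * (κ * ψ₂ q) / 2)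
    (hx : tightMultiplier ψ₁ ψ₂ θ P κ x ≠ 0) : x ∈ tightLayer ψ₁ ψ₂ θ P κ := by
  obtain ⟨q, hq, n, hn⟩ := exists_mem_abs_sub_intCast_le_of_averagedBump_ne_zero hψ₂ hx
  rw [abs_le] at hn
  exact ⟨q, hq, n, by linarith [hn.1], by linarith [hn.2]⟩

theorem isCoprime_of_pos_of_lt_prime {n : ℤ} {q : ℕ} (hq : q.Prime) (hn : 0 < n) (hnq : n < q) :
    IsCoprime n (q : ℤ) :=
  ((Nat.prime_iff_prime_int.1 hq).coprime_iff_not_dvd.2 fun hdvd =>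
    (Int.le_of_dvd hn hdvd).not_gt hnq).symm

theorem exists_mem_approxPairs_of_mem_tightLayer
    (hP : ∀ q ∈ P, q.Prime ∧ 8 * |θ| < q ∧ ψ₁ q ≤ 1 / 8 ∧ κ * ψ₂ q ≤ ψ₁ q)
    (hx : x ∈ Set.Icc (1 / 4 : ℝ) (3 / 4)) (hxP : x ∈ tightLayer ψ₁ ψ₂ θ P κ) :
    ∃ q ∈ P, ∃ n : ℤ, (n, q) ∈ approxPairs ψ₁ θ x ∧
      ψ₁ q - κ * ψ₂ q ≤ |x - ((n : ℝ) - θ) / q| := by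
  obtain ⟨q, hqP, n, hlow, hup⟩ := hxP
  obtain ⟨hq, hθ, hψ₁, hψ⟩ := hP q hqP
  have hq₀ : (0 : ℝ) < q := by exact_mod_cast hq.pos
  have hdiff : x - ((n : ℝ) - θ) / q = (q * x + θ - n) / q := by field_simp; ring
  have hlow_div : ψ₁ q - κ * ψ₂ q ≤ x - (n - θ) / q := by
    rwa [hdiff, le_div_iff₀' hq₀]
  have hup_div : x - (n - θ) / q ≤ ψ₁ q := by rwa [hdiff, div_le_iff₀' hq₀]
  -- Since `x` is away from `0` and `1`, the numerator lies strictly between `0` and `q`.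
  have hn : 0 < n ∧ n < q := by
    obtain ⟨hθ_neg, hθ_pos⟩ := abs_lt.1 (by linarith : |θ| < q / 8)
    have hlow₀ : 0 ≤ q * x + θ - n := (mul_nonneg hq₀.le (by linarith)).trans hlow
    have hx₀ : q * (1 / 4) ≤ q * x := by gcongr; exact hx.1
    have hx₁ : q * x ≤ q * (3 / 4) := by gcongr; exact hx.2
    have hψq : q * ψ₁ q ≤ q * (1 / 8) := by gcongr
    constructor <;> rify <;> linarith
  refine ⟨q, hqP, n, ⟨hq.pos, isCoprime_of_pos_of_lt_prime hq hn.1 hn.2, ?_⟩,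
    hlow_div.trans (le_abs_self _)⟩
  exact abs_le.2 ⟨by linarith, hup_div⟩

end TightLayers

section Levels

open scoped FourierTransform

theorem eventually_forall_mem_primesIoc {p : ℕ → Prop} {s : ℝ} (hs : 0 < s)
    (hp : ∀ᶠ q in atTop, p q) : ∀ᶠ N : ℝ in atTop, ∀ q ∈ primesIoc (N ^ s) N, p q := by
  obtain ⟨Q, hQ⟩ := eventually_atTop.1 hp
  filter_upwards [eventually_lt_rpow hs Q, eventually_ge_atTop 0] with N hNQ hN q hq
  exact hQ q (by exact_mod_cast (hNQ.trans ((mem_primesIoc hN).1 hq).2.1).le)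

theorem exists_eventually_card_primesIoc_dvd_le {s : ℝ} (hs : 0 < s) (t : ℝ) :
    ∃ D : ℝ, 0 ≤ D ∧ ∀ᶠ N : ℝ in atTop, ∀ z : ℤ, z ≠ 0 →
      (({q ∈ primesIoc (N ^ s) N | (q : ℤ) ∣ z} : Finset ℕ).card : ℝ) ≤
        D * (1 + |(z : ℝ)| / N ^ t) := by
  refine ⟨max 1 (t / s), le_max_of_le_left zero_le_one, ?_⟩
  filter_upwards [eventually_lt_rpow hs (Real.exp 1), eventually_ge_atTop 1] with N hNs hN z hz
  have hN₀ : 0 < N := by linarith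
  have hY : 0 < N ^ s := by positivity
  refine card_prime_dvd_le (Y := N ^ s)
    (fun q hq => ((mem_primesIoc hN₀.le).1 hq).imp_right fun h => h.1.le) hY
    ((Real.le_log_iff_exp_le hY).2 hNs.le) (by positivity) (le_max_left _ _) ?_ hz
  have : 0 ≤ Real.log N := Real.log_nonneg hN
  rw [Real.log_rpow hN₀, Real.log_rpow hN₀, ← mul_assoc]
  gcongr
  rw [← div_le_iff₀ hs]
  exact le_max_right _ _

theorem exists_eventually_norm_fourier_mul_averagedBump_sub_le {s t u a η : ℝ} (hs₀ : 0 < s)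
    (hs₁ : s < 1) (hu : 0 ≤ u) (hut : 2 * u ≤ t) (ha₀ : 0 ≤ a) (ha₁ : a < 1)
    (hη : t * a + u * (1 - a) + η ≤ s) :
    ∃ C : ℝ, 0 ≤ C ∧ ∀ᶠ N : ℝ in atTop, ∀ (w τ : ℕ → ℝ) (B : ℝ) (f : ℝ → ℂ), 0 ≤ B →
      Integrable f → (∀ ξ, ‖𝓕 f ξ‖ ≤ B * decayWeight a (N ^ u) ξ) →
      (∀ q ∈ primesIoc (N ^ s) N, (q : ℝ) / N ^ t ≤ w q) →
      ∀ ξ, ‖𝓕 (fun x => f x * (averagedBump (primesIoc (N ^ s) N) w τ x : ℂ)) ξ - 𝓕 f ξ‖ ≤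
        C * B * N ^ (-η) * decayWeight a (N ^ t) ξ := by
  obtain ⟨C, hC, hC_bump⟩ := exists_norm_fourier_unitBump_le 7
  obtain ⟨D, hD, hD_card⟩ := exists_eventually_card_primesIoc_dvd_le hs₀ t
  have : 0 ≤ 32 / (1 - a) := div_nonneg (by norm_num) (by linarith)
  refine ⟨C * D * (32 / (1 - a)), by positivity, ?_⟩
  filter_upwards [hD_card, eventually_rpow_le_card_primesIoc hs₁, eventually_ge_atTop 1] with
    N hdvd hcard hN w τ B f hB hf hf_decay hw ξ
  have hN₀ : 0 < N := by linarith
  have hP : (primesIoc (N ^ s) N).Nonempty := by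
    rw [← Finset.card_pos]
    exact_mod_cast (Real.rpow_pos_of_pos hN₀ s).trans_le hcard
  have hsq : (N ^ u) ^ 2 ≤ N ^ t := by
    rw [← Real.rpow_mul_natCast hN₀.le]
    exact Real.rpow_le_rpow_of_exponent_le hN (by push_cast; linarith)
  have hscales : N ^ (-s) * ((N ^ t) ^ a * (N ^ u) ^ (1 - a)) ≤ N ^ (-η) := by
    rw [← Real.rpow_mul hN₀.le, ← Real.rpow_mul hN₀.le, ← Real.rpow_add hN₀, ← Real.rpow_add hN₀]
    exact Real.rpow_le_rpow_of_exponent_le hN (by linarith)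
  refine (norm_fourier_mul_averagedBump_sub_le hf hP
    (fun q hq => ((mem_primesIoc hN₀.le).1 hq).1.ne_zero) hC.le hD hB ha₀ ha₁
    (Real.one_le_rpow hN hu) hsq hC_bump hf_decay hw hdvd ξ).trans ?_
  refine mul_le_mul_of_nonneg_right ?_ (decayWeight_nonneg (by positivity) ξ)
  calc ((primesIoc (N ^ s) N).card : ℝ)⁻¹ * (C * D * B) *
        (32 / (1 - a) * (N ^ t) ^ a * (N ^ u) ^ (1 - a))
      ≤ N ^ (-s) * (C * D * B) * (32 / (1 - a) * (N ^ t) ^ a * (N ^ u) ^ (1 - a)) := by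
        rw [Real.rpow_neg hN₀.le]
        gcongr
    _ = C * D * (32 / (1 - a)) * B * (N ^ (-s) * ((N ^ t) ^ a * (N ^ u) ^ (1 - a))) := by ring
    _ ≤ C * D * (32 / (1 - a)) * B * N ^ (-η) := by gcongr

theorem exists_superexponential_scales {β η : ℝ} {p : ℝ → Prop} (hβ : 1 < β) (hη : 0 < η) (A : ℝ)
    (hp : ∀ᶠ N in atTop, p N) :
    ∃ N : ℕ → ℝ, (∀ k, 1 ≤ N k) ∧ (∀ k, N (k + 1) = N k ^ β) ∧ Tendsto N atTop atTop ∧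
      (∀ k, p (N k)) ∧ ∀ k, A * N k ^ (-η) ≤ (1 / 2) ^ k := by
  have hβη : 0 < (β - 1) * η := mul_pos (by linarith) hη
  obtain ⟨X, hX⟩ := eventually_atTop.1 (hp.and (eventually_lt_rpow hβη 2))
  obtain ⟨N₀, hN₀X, hN₀, hN₀A⟩ :=
    ((eventually_ge_atTop X).and ((eventually_gt_atTop 1).and (eventually_lt_rpow hη A))).exists
  have hge (k : ℕ) : N₀ ≤ N₀ ^ (β ^ k) :=
    Real.self_le_rpow_of_one_le hN₀.le (one_le_pow₀ hβ.le)
  have hsucc (k : ℕ) : N₀ ^ (β ^ (k + 1)) = (N₀ ^ (β ^ k)) ^ β := by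
    rw [← Real.rpow_mul (by linarith), pow_succ]
  have hgrowth (k : ℕ) : A * 2 ^ k ≤ (N₀ ^ (β ^ k)) ^ η := by
    induction k with
    | zero => simpa using hN₀A.le
    | succ k ih =>
      have hNk : 0 < N₀ ^ (β ^ k) := by linarith [hge k]
      calc A * 2 ^ (k + 1) = A * 2 ^ k * 2 := by ring
        _ ≤ (N₀ ^ (β ^ k)) ^ η * (N₀ ^ (β ^ k)) ^ ((β - 1) * η) := by
            have := (hX _ (hN₀X.trans (hge k))).2.le
            gcongr
        _ = (N₀ ^ (β ^ (k + 1))) ^ η := by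
            rw [hsucc, ← Real.rpow_add hNk, ← Real.rpow_mul hNk.le]
            ring_nf
  refine ⟨fun k => N₀ ^ (β ^ k), fun k => hN₀.le.trans (hge k), hsucc,
    (tendsto_rpow_atTop_of_base_gt_one N₀ hN₀).comp (tendsto_pow_atTop_atTop_of_one_lt hβ),
    fun k => (hX _ (hN₀X.trans (hge k))).1, fun k => ?_⟩
  have hNk : 0 < N₀ ^ (β ^ k) := by linarith [hge k]
  rw [Real.rpow_neg hNk.le, ← div_eq_mul_inv, div_le_iff₀ (by positivity), one_div_pow,
    one_div_mul_eq_div, le_div_iff₀ (by positivity)]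
  exact hgrowth k

/-- The smooth probability density on `[1/4, 3/4]` from which the construction starts. Staying away
from the integers makes numerators automatically coprime to prime denominators. -/
noncomputable def initialDensity : ℝ → ℝ :=
  (⟨1 / 8, 1 / 4, by norm_num, by norm_num⟩ : ContDiffBump (1 / 2 : ℝ)).normed volume

theorem continuous_initialDensity : Continuous initialDensity :=
  ContDiffBump.continuous_normed _

theorem initialDensity_nonneg (x : ℝ) : 0 ≤ initialDensity x :=
  ContDiffBump.nonneg_normed _ x

theorem integral_initialDensity : ∫ x, initialDensity x = 1 :=
  ContDiffBump.integral_normed _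

theorem mem_Icc_of_initialDensity_ne_zero {x : ℝ} (hx : initialDensity x ≠ 0) :
    x ∈ Set.Icc (1 / 4 : ℝ) (3 / 4) := by
  have hx' : x ∈ Function.support initialDensity := hx
  rw [initialDensity, ContDiffBump.support_normed_eq, Metric.mem_ball, Real.dist_eq, abs_lt] at hx'
  constructor <;> linarith [hx'.1, hx'.2]

theorem exists_norm_fourier_initialDensity_le : ∃ B : ℝ, 0 < B ∧ ∀ a m ξ : ℝ, a ≤ 1 → 1 ≤ m →
    ‖𝓕 (fun x => (initialDensity x : ℂ)) ξ‖ ≤ B * decayWeight a m ξ := by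
  obtain ⟨B, hB, hB_decay⟩ := exists_norm_fourier_normed_le
    (⟨1 / 8, 1 / 4, by norm_num, by norm_num⟩ : ContDiffBump (1 / 2 : ℝ)) 4
  refine ⟨B, hB, fun a m ξ ha hm => (hB_decay ξ).trans ?_⟩
  rw [div_eq_mul_inv]
  gcongr
  exact inv_one_add_abs_pow_four_le_decayWeight ha hm ξ

end Levels

section Construction

open scoped FourierTransform

variable {ψ₁ ψ₂ : ℕ → ℝ} {θ a b ε t : ℝ}

theorem Icc_inter_iInter_tightLayer_subset_tight {N : ℕ → ℝ} (hψ₂ : ∀ q, 1 ≤ q → 0 < ψ₂ q)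
    (hψ : ∀ q, 1 ≤ q → ψ₂ q ≤ ψ₁ q) (hb : 0 < b) (hε : ε < 1) (hN₀ : ∀ k, 1 ≤ N k)
    (hN : Tendsto N atTop atTop) (hN_succ : ∀ k, N (k + 1) = N k ^ (b ^ 2))
    (hwindow : ∀ k, WindowIsolated ψ₁ θ b ε (N k))
    (hlarge : ∀ k, ∀ q ∈ primesIoc (N k ^ (1 - ε)) (N k), 8 * |θ| < q ∧ ψ₁ q ≤ 1 / 8) :
    Set.Icc (1 / 4) (3 / 4) ∩
      ⋂ k, tightLayer ψ₁ ψ₂ θ (primesIoc (N k ^ (1 - ε)) (N k)) (1 / (k + 1)) ⊆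
        Tight ψ₁ ψ₂ θ := by
  rintro x ⟨hx, hxlayer⟩
  have hmem (k q : ℕ) (hq : q ∈ primesIoc (N k ^ (1 - ε)) (N k)) :
      q.Prime ∧ N k ^ (1 - ε) < q ∧ (q : ℝ) ≤ N k :=
    (mem_primesIoc (zero_le_one.trans (hN₀ k))).1 hq
  choose q hqP r happrox hlow using fun k => exists_mem_approxPairs_of_mem_tightLayer
    (fun q hq => ⟨(hmem k q hq).1, (hlarge k q hq).1, (hlarge k q hq).2,
      (mul_le_of_le_one_left (hψ₂ q (hmem k q hq).1.pos).le
        (div_le_one_of_le₀ (by linarith [k.cast_nonneg (α := ℝ)]) (by positivity))).trans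
        (hψ q (hmem k q hq).1.pos)⟩) hx (Set.mem_iInter.1 hxlayer k)
  have hq : Tendsto q atTop atTop := by
    rw [← tendsto_natCast_atTop_iff (R := ℝ)]
    exact tendsto_atTop_mono (fun k => (hmem k (q k) (hqP k)).2.1.le)
      ((tendsto_rpow_atTop (sub_pos.2 hε)).comp hN)
  -- Consecutive windows `[N k ^ b⁻¹, N k ^ b)` are adjacent, since `N (k + 1) ^ b⁻¹ = N k ^ b`.
  refine mem_tight_of_windows hψ₂ ((tendsto_rpow_atTop (inv_pos.2 hb)).comp hN)
    tendsto_one_div_add_atTop_nhds_zero_nat hq happrox hlow fun k r' q' hcop hle hlt hne => ?_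
  refine hwindow k _ _ _ _ (hmem k _ (hqP k)).2.1 (hmem k _ (hqP k)).2.2 (happrox k).2.1 hcop hle
    (hlt.trans_eq ?_) hne
  rw [Function.comp_apply, hN_succ, ← Real.rpow_mul (zero_le_one.trans (hN₀ k))]
  congr 1
  field_simp

theorem SupportsFourierDecay.mono {E E' : Set ℝ} {s : ℝ} (h : SupportsFourierDecay E s)
    (hE : E ⊆ E') : SupportsFourierDecay E' s := by
  obtain ⟨μ, K, C, hμ, hK, hKE, hμK, hdecay⟩ := h
  exact ⟨μ, K, C, hμ, hK, hKE.trans hE, hμK, hdecay⟩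

theorem div_rpow_le_mul_div_two {N κ y : ℝ} (hN : 0 < N) (hκ : 2 * N ^ (-ε) ≤ κ)
    (hy : N ^ (-(t - ε)) ≤ y) (q : ℕ) : q / N ^ t ≤ q * (κ * y) / 2 := by
  have : 0 ≤ κ := le_trans (by positivity) hκ
  calc q / N ^ t = q * (2 * N ^ (-ε) * N ^ (-(t - ε))) / 2 := by
        rw [mul_assoc, ← Real.rpow_add hN, show -ε + -(t - ε) = -t by ring, Real.rpow_neg hN.le]
        ring
    _ ≤ q * (κ * y) / 2 := by gcongr

theorem exists_eventually_norm_fourier_mul_tightMultiplier_sub_le {u η : ℝ} (hε : 0 < ε)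
    (hε₁ : ε < 1) (hεt : ε ≤ t) (hu : 0 ≤ u) (hut : 2 * u ≤ t) (ha₀ : 0 ≤ a) (ha₁ : a < 1)
    (hη : t * a + u * (1 - a) + η ≤ 1 - ε)
    (hψ₂ : ∀ᶠ q : ℕ in atTop, (q : ℝ) ^ (-(t - ε)) ≤ ψ₂ q) :
    ∃ C : ℝ, 0 ≤ C ∧ ∀ᶠ N : ℝ in atTop, ∀ (κ B : ℝ) (f : ℝ → ℂ), 2 * N ^ (-ε) ≤ κ → 0 ≤ B →
      Integrable f → (∀ ξ, ‖𝓕 f ξ‖ ≤ B * decayWeight a (N ^ u) ξ) →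
      ∀ ξ, ‖𝓕 (fun x => f x *
          (tightMultiplier ψ₁ ψ₂ θ (primesIoc (N ^ (1 - ε)) N) κ x : ℂ)) ξ - 𝓕 f ξ‖ ≤
        C * B * N ^ (-η) * decayWeight a (N ^ t) ξ := by
  obtain ⟨C, hC, hlevel⟩ := exists_eventually_norm_fourier_mul_averagedBump_sub_le
    (sub_pos.2 hε₁) (sub_lt_self 1 hε) hu hut ha₀ ha₁ hη
  refine ⟨C, hC, ?_⟩
  filter_upwards [hlevel, eventually_forall_mem_primesIoc (sub_pos.2 hε₁) hψ₂,
    eventually_gt_atTop 0] with N hN hNψ₂ hN₀ κ B f hκ hB hf hf_decay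
  refine hN _ _ B f hB hf hf_decay fun q hq => div_rpow_le_mul_div_two hN₀ hκ ?_ q
  obtain ⟨hq_prime, -, hqN⟩ := (mem_primesIoc hN₀.le).1 hq
  exact (Real.rpow_le_rpow_of_nonpos (by exact_mod_cast hq_prime.pos) hqN (by linarith)).trans
    (hNψ₂ q hq)

theorem supportsFourierDecay_tight_of_scales {N : ℕ → ℝ} {B : ℝ} (hψ₂ : ∀ q, 1 ≤ q → 0 < ψ₂ q)
    (hψ : ∀ q, 1 ≤ q → ψ₂ q ≤ ψ₁ q) (hb : 1 ≤ b ^ 2) (hb₀ : 0 < b) (hε : ε < 1) (ht : 0 ≤ t)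
    (ha : 0 ≤ a) (hN₁ : ∀ k, 1 ≤ N k) (hN_top : Tendsto N atTop atTop)
    (hN_succ : ∀ k, N (k + 1) = N k ^ (b ^ 2)) (hwindow : ∀ k, WindowIsolated ψ₁ θ b ε (N k))
    (hlarge : ∀ k, ∀ q ∈ primesIoc (N k ^ (1 - ε)) (N k), 8 * |θ| < q ∧ ψ₁ q ≤ 1 / 8) (hB : 0 ≤ B)
    (hB_decay : ∀ m ξ, 1 ≤ m → ‖𝓕 (fun x => (initialDensity x : ℂ)) ξ‖ ≤ B * decayWeight a m ξ)
    (hstep : ∀ (k : ℕ) (f : ℝ → ℂ), Integrable f →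
      (∀ ξ, ‖𝓕 f ξ‖ ≤ (B + 1) * decayWeight a (N k ^ (t / b ^ 2)) ξ) → ∀ ξ,
        ‖𝓕 (fun x => f x * (tightMultiplier ψ₁ ψ₂ θ (primesIoc (N k ^ (1 - ε)) (N k))
            (1 / (k + 1)) x : ℂ)) ξ - 𝓕 f ξ‖ ≤
          (1 / 2) ^ (k + 2) * decayWeight a (N k ^ t) ξ) :
    SupportsFourierDecay (Tight ψ₁ ψ₂ θ) (2 * a) := by
  have hN₀ (k : ℕ) : 0 < N k := by linarith [hN₁ k]
  have hm_succ (k : ℕ) : N (k + 1) ^ (t / b ^ 2) = N k ^ t := by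
    rw [hN_succ, ← Real.rpow_mul (hN₀ k).le, mul_div_cancel₀ _ (by positivity)]
  have hwidth (k q : ℕ) (hq : q ∈ primesIoc (N k ^ (1 - ε)) (N k)) :
      0 < q * (1 / ((k : ℝ) + 1) * ψ₂ q) / 2 := by
    have hq_pos : 0 < q := ((mem_primesIoc (hN₀ k).le).1 hq).1.pos
    have := hψ₂ q hq_pos
    positivity
  refine (supportsFourierDecay_of_multipliers (m := fun k => N k ^ (t / b ^ 2)) ha hB
    (fun k => Real.rpow_pos_of_pos (hN₀ k) _) (fun k => ?_) continuous_initialDensity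
    initialDensity_nonneg integral_initialDensity isCompact_Icc
    (fun x => mem_Icc_of_initialDensity_ne_zero)
    (fun ξ => hB_decay _ ξ (Real.one_le_rpow (hN₁ 0) (by positivity)))
    (fun k => continuous_averagedBump (hwidth k)) (fun k => averagedBump_nonneg (hwidth k))
    (fun k => isClosed_tightLayer ψ₁ ψ₂ θ _ _)
    (fun k x => mem_tightLayer_of_tightMultiplier_ne_zero (hwidth k))
    fun k f hf hf_decay ξ => ?_).mono
    (Icc_inter_iInter_tightLayer_subset_tight hψ₂ hψ hb₀ hε hN₁ hN_top hN_succ hwindow hlarge)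
  · rw [hm_succ]
    exact Real.rpow_le_rpow_of_exponent_le (hN₁ k) (div_le_self ht hb)
  · rw [hm_succ]
    exact hstep k f hf hf_decay ξ

theorem supportsFourierDecay_tight (hψ₂_pos : ∀ q, 1 ≤ q → 0 < ψ₂ q)
    (hψ_le : ∀ q, 1 ≤ q → ψ₂ q ≤ ψ₁ q) (hb : 0 < b) (hb₂ : 2 ≤ b ^ 2) (hε : 0 < ε) (hε₁ : ε < 1)
    (ht : ε ≤ t) (ha₀ : 0 ≤ a) (ha₁ : a < 1) (hta : t * a + t / b ^ 2 * (1 - a) < 1 - ε)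
    (hwindow : ∀ᶠ N in atTop, WindowIsolated ψ₁ θ b ε N) (hψ₁ : Tendsto ψ₁ atTop (𝓝 0))
    (hψ₂ : ∀ᶠ q : ℕ in atTop, (q : ℝ) ^ (-(t - ε)) ≤ ψ₂ q) :
    SupportsFourierDecay (Tight ψ₁ ψ₂ θ) (2 * a) := by
  obtain ⟨B, hB, hB_decay⟩ := exists_norm_fourier_initialDensity_le
  have ht₀ : 0 < t := hε.trans_le ht
  have hut : 2 * (t / b ^ 2) ≤ t := by
    rw [← mul_div_assoc, div_le_iff₀ (by positivity), mul_comm]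
    gcongr
  set η : ℝ := min ε (1 - ε - (t * a + t / b ^ 2 * (1 - a)))
  obtain ⟨C, _, hlevel⟩ := exists_eventually_norm_fourier_mul_tightMultiplier_sub_le
    (ψ₁ := ψ₁) (θ := θ) (η := η) hε hε₁ ht (by positivity) hut ha₀ ha₁
    (by linarith [min_le_right ε (1 - ε - (t * a + t / b ^ 2 * (1 - a)))]) hψ₂
  have hlarge := eventually_forall_mem_primesIoc (sub_pos.2 hε₁)
    (((tendsto_natCast_atTop_atTop (R := ℝ)).eventually_gt_atTop (8 * |θ|)).and
      (hψ₁.eventually_le_const (by norm_num : (0 : ℝ) < 1 / 8)))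
  obtain ⟨N, hN₁, hN_succ, hN_top, hN, hgrowth⟩ := exists_superexponential_scales
    (by linarith : 1 < b ^ 2) (lt_min hε (by linarith) : 0 < η) (max 2 (4 * (C * (B + 1))))
    (hwindow.and (hlarge.and hlevel))
  have hNη (k : ℕ) : 0 < N k ^ (-η) := Real.rpow_pos_of_pos (by linarith [hN₁ k]) _
  have hκ (k : ℕ) : 2 * N k ^ (-ε) ≤ 1 / (k + 1) := by
    have hη_le : -ε ≤ -η := neg_le_neg (min_le_left _ _)
    calc 2 * N k ^ (-ε) ≤ max 2 (4 * (C * (B + 1))) * N k ^ (-η) :=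
          mul_le_mul (le_max_left _ _) (Real.rpow_le_rpow_of_exponent_le (hN₁ k) hη_le)
            (Real.rpow_nonneg (by linarith [hN₁ k]) _) (by positivity)
      _ ≤ (1 / 2) ^ k := hgrowth k
      _ ≤ 1 / (k + 1) := by
          rw [one_div_pow]
          gcongr
          exact_mod_cast Nat.lt_two_pow_self
  refine supportsFourierDecay_tight_of_scales hψ₂_pos hψ_le (by linarith) hb hε₁ ht₀.le ha₀ hN₁
    hN_top hN_succ (fun k => (hN k).1) (fun k => (hN k).2.1) hB.le
    (fun m ξ hm => hB_decay a m ξ ha₁.le hm) fun k f hf hf_decay ξ =>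
      ((hN k).2.2 _ _ f (hκ k) (by positivity) hf hf_decay ξ).trans ?_
  refine mul_le_mul_of_nonneg_right ?_ (decayWeight_nonneg (by have := hN₁ k; positivity) ξ)
  rw [pow_add]
  linarith [hgrowth k, mul_le_mul_of_nonneg_right (le_max_right 2 (4 * (C * (B + 1)))) (hNη k).le]

end Construction

section Exponents

variable {θ γ τ₁ τ₂ β a : ℝ} {ψ₁ ψ₂ : ℕ → ℝ}

theorem exists_lt_mul_add_div_sq_mul_lt_one {b₀ : ℝ} (hτ : 0 < τ₂) (hb₀ : 0 < b₀)
    (hb₀_sq : 2 < b₀ ^ 2) (ha : a < (b₀ ^ 2 - τ₂) / (τ₂ * (b₀ ^ 2 - 1))) :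
    ∃ b, 0 < b ∧ b < b₀ ∧ 2 < b ^ 2 ∧ τ₂ * a + τ₂ / b ^ 2 * (1 - a) < 1 := by
  have hlimit : τ₂ * a + τ₂ / b₀ ^ 2 * (1 - a) < 1 := by
    rw [lt_div_iff₀ (mul_pos hτ (by linarith))] at ha
    rw [← lt_sub_iff_add_lt', div_mul_eq_mul_div, div_lt_iff₀ (by positivity)]
    linarith
  have hsq : b₀ ^ 2 ≠ 0 := by positivity
  have hcont : ContinuousAt (fun b : ℝ => τ₂ * a + τ₂ / b ^ 2 * (1 - a)) b₀ := by
    fun_prop (disch := assumption)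
  have hnhds : ∀ᶠ b in 𝓝 b₀, 0 < b ∧ 2 < b ^ 2 ∧ τ₂ * a + τ₂ / b ^ 2 * (1 - a) < 1 :=
    (lt_mem_nhds hb₀).and <| ((continuous_pow 2).continuousAt.eventually_const_lt hb₀_sq).and <|
      hcont.eventually_lt_const hlimit
  have hleft : ∀ᶠ b in 𝓝[<] b₀, b < b₀ := self_mem_nhdsWithin
  obtain ⟨b, ⟨hb, hb_sq, hab⟩, hlt⟩ := ((hnhds.filter_mono nhdsWithin_le_nhds).and hleft).exists
  exact ⟨b, hb, hlt, hb_sq, hab⟩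

theorem exists_pos_slack {b : ℝ} (hτ₁ : 1 < τ₁) (hb : b * γ < τ₁ - 1)
    (hab : τ₂ * a + τ₂ / b ^ 2 * (1 - a) < 1) :
    ∃ ε, 0 < ε ∧ ε < 1 ∧ 1 < τ₁ - ε ∧ b * (γ + ε) < (1 - ε) * (τ₁ - ε - 1) ∧
      (τ₂ + 2 * ε) * a + (τ₂ + 2 * ε) / b ^ 2 * (1 - a) < 1 - ε := by
  have hlt (f g : ℝ → ℝ) (hf : Continuous f) (hg : Continuous g) (h : f 0 < g 0) :
      ∀ᶠ ε in 𝓝[>] 0, f ε < g ε :=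
    (hf.continuousAt.eventually_lt hg.continuousAt h).filter_mono nhdsWithin_le_nhds
  have hpos : ∀ᶠ ε : ℝ in 𝓝[>] 0, 0 < ε := self_mem_nhdsWithin
  exact (hpos.and <|
    (hlt _ _ (by fun_prop) (by fun_prop) (by simp)).and <|
    (hlt _ _ (by fun_prop) (by fun_prop) (by simpa using hτ₁)).and <|
    (hlt _ _ (by fun_prop) (by fun_prop) (by simpa using hb)).and <|
    hlt _ _ (by fun_prop) (by fun_prop) (by simpa using hab)).exists

theorem tendsto_zero_of_hasOrder {ψ : ℕ → ℝ} {τ : ℝ} (hψ : ∀ q, 1 ≤ q → 0 < ψ q)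
    (h : HasOrder ψ τ) (hτ : 0 < τ) : Tendsto ψ atTop (𝓝 0) := by
  refine squeeze_zero' (f := ψ) ?_ ?_
    ((tendsto_rpow_neg_atTop (half_pos hτ)).comp tendsto_natCast_atTop_atTop)
  · filter_upwards [eventually_ge_atTop 1] with q hq using (hψ q hq).le
  · filter_upwards [eventually_rpow_bounds_of_hasOrder hψ h (half_pos hτ)] with q hq
    simpa [sub_half] using hq.2

theorem supportsFourierDecay_tight_of_lt
    (hθ : (θ = 0 ∧ γ = 1) ∨ (Irrational θ ∧ HasDiophantineExponent θ γ))
    (hψ₂_pos : ∀ q : ℕ, 1 ≤ q → 0 < ψ₂ q) (hψ_le : ∀ q : ℕ, 1 ≤ q → ψ₂ q ≤ ψ₁ q)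
    (hτ₁ : HasOrder ψ₁ τ₁) (hτ₂ : HasOrder ψ₂ τ₂) (hτ₁_gt : 1 < τ₁) (hγ : 1 ≤ γ)
    (hβ : β = ((τ₁ - 1) / γ) ^ 2) (hβ₂ : 2 < β) (ha₀ : 0 ≤ a) (ha₁ : a < 1)
    (haβ : a < (β - τ₂) / (τ₂ * (β - 1))) :
    SupportsFourierDecay (Tight ψ₁ ψ₂ θ) (2 * a) := by
  have hψ₁_pos (q : ℕ) (hq : 1 ≤ q) : 0 < ψ₁ q := (hψ₂_pos q hq).trans_le (hψ_le q hq)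
  have hτ₂_pos : 0 < τ₂ := by linarith [hτ₁.le_of_le hτ₂ hψ₂_pos hψ_le]
  have hγ_pos : 0 < γ := by linarith
  subst hβ
  obtain ⟨b, hb, hb_lt, hb_sq, hab⟩ := exists_lt_mul_add_div_sq_mul_lt_one hτ₂_pos
    (div_pos (by linarith) hγ_pos) hβ₂ haβ
  obtain ⟨ε, hε, hε₁, hτ₁ε, hbε, habε⟩ := exists_pos_slack hτ₁_gt ((lt_div_iff₀ hγ_pos).1 hb_lt) hab
  have hsep : ShiftedFractionsSeparated θ (γ + ε) := by
    rcases hθ with ⟨rfl, rfl⟩ | ⟨hθ, hγθ⟩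
    · exact shiftedFractionsSeparated_zero (by linarith)
    · exact shiftedFractionsSeparated_of_irrational hθ hγθ (by linarith)
  refine supportsFourierDecay_tight hψ₂_pos hψ_le hb hb_sq.le hε hε₁ (by linarith) ha₀ ha₁ habε
    (eventually_windowIsolated hsep (by linarith) hτ₁ε.le hb hε hε₁ hbε ?_)
    (tendsto_zero_of_hasOrder hψ₁_pos hτ₁ (by linarith)) ?_
  · filter_upwards [eventually_rpow_bounds_of_hasOrder hψ₁_pos hτ₁ hε] with q hq using hq.2
  · filter_upwards [eventually_rpow_bounds_of_hasOrder hψ₂_pos hτ₂ hε] with q hq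
    rw [show τ₂ + 2 * ε - ε = τ₂ + ε by ring]
    exact hq.1

end Exponents

theorem le_fourierDim {E : Set ℝ} {s : ℝ} (hs₀ : 0 ≤ s) (hs₁ : s ≤ 1)
    (h : SupportsFourierDecay E s) : s ≤ fourierDim E :=
  le_csSup ⟨1, fun _ hx => hx.2.1⟩ ⟨hs₀, hs₁, h⟩

theorem le_fourierDim_of_forall_lt {E : Set ℝ} {S : ℝ} (hS₀ : 0 < S) (hS₁ : S ≤ 1)
    (h : ∀ s, 0 ≤ s → s < S → SupportsFourierDecay E s) : S ≤ fourierDim E := by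
  refine le_of_forall_lt_imp_le_of_dense fun s hs => ?_
  have hmax : max s 0 < S := max_lt hs hS₀
  exact (le_max_left s 0).trans
    (le_fourierDim (le_max_right s 0) (hmax.le.trans hS₁) (h _ (le_max_right s 0) hmax))

theorem theorem2_general (θ γ τ₁ τ₂ β : ℝ) (ψ₁ ψ₂ : ℕ → ℝ)
    (hθ : (θ = 0 ∧ γ = 1) ∨ (Irrational θ ∧ HasDiophantineExponent θ γ))
    (hψ₂_pos : ∀ q : ℕ, 1 ≤ q → 0 < ψ₂ q)
    (hψ_le : ∀ q : ℕ, 1 ≤ q → ψ₂ q ≤ ψ₁ q)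
    (hτ₁ : HasOrder ψ₁ τ₁) (hτ₂ : HasOrder ψ₂ τ₂)
    (hτ₁_gt : 1 < τ₁)
    (hβ : β = γ⁻¹ ^ 2 * (τ₁ - 1) ^ 2)
    (hβτ₂ : τ₂ < β) :
    0 < fourierDim (Tight ψ₁ ψ₂ θ) ∧
      2 * (β - τ₂) / (τ₂ * (β - 1)) ≤ fourierDim (Tight ψ₁ ψ₂ θ) := by
  have hτ : τ₁ ≤ τ₂ := hτ₁.le_of_le hτ₂ hψ₂_pos hψ_le
  have hγ : 1 ≤ γ := hθ.elim (fun h => h.2.ge) fun h => one_le_of_hasDiophantineExponent h.2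
  have hβ_le : β ≤ (τ₁ - 1) ^ 2 :=
    hβ.trans_le (mul_le_of_le_one_left (sq_nonneg _)
      (pow_le_one₀ (by positivity) (inv_le_one_of_one_le₀ hγ)))
  -- `τ₁ ≤ τ₂ < β ≤ (τ₁ - 1) ^ 2` forces `τ₁ > 2`.
  have hτ₂_gt : 2 < τ₂ := by nlinarith
  have hden : 0 < τ₂ * (β - 1) := mul_pos (by linarith) (by linarith)
  have hS : 0 < 2 * (β - τ₂) / (τ₂ * (β - 1)) := div_pos (by linarith) hden
  have hS₁ : 2 * (β - τ₂) / (τ₂ * (β - 1)) ≤ 1 := by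
    rw [div_le_one hden]
    nlinarith
  have hle := le_fourierDim_of_forall_lt hS hS₁ fun s hs₀ hs => by
    rw [← mul_div_cancel₀ s two_ne_zero]
    rw [mul_div_assoc] at hs hS₁
    exact supportsFourierDecay_tight_of_lt hθ hψ₂_pos hψ_le hτ₁ hτ₂ hτ₁_gt hγ
      (hβ.trans (by ring)) (hτ₂_gt.trans hβτ₂) (by linarith) (by linarith) (by linarith)
  exact ⟨hS.trans_le hle, hle⟩

theorem theorem2 (θ γ τ₁ τ₂ β : ℝ) (ψ₁ ψ₂ : ℕ → ℝ)
    (hθ_mem : θ ∈ Set.Ico (0 : ℝ) 1)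
    (hθ : (θ = 0 ∧ γ = 1) ∨ (Irrational θ ∧ HasDiophantineExponent θ γ))
    (hψ₂_pos : ∀ q : ℕ, 1 ≤ q → 0 < ψ₂ q)
    (hψ_le : ∀ q : ℕ, 1 ≤ q → ψ₂ q ≤ ψ₁ q)
    (hψ₁_anti : AntitoneOn ψ₁ (Set.Ici 1))
    (hψ₂_anti : AntitoneOn ψ₂ (Set.Ici 1))
    (hdiff_anti : AntitoneOn (fun q => ψ₁ q - ψ₂ q) (Set.Ici 1))
    (hτ₁ : HasOrder ψ₁ τ₁) (hτ₂ : HasOrder ψ₂ τ₂)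
    (hτ₁_gt : 1 < τ₁)
    (hβ : β = γ⁻¹ ^ 2 * (τ₁ - 1) ^ 2)
    (hβτ₂ : τ₂ < β) :
    0 < fourierDim (Tight ψ₁ ψ₂ θ) ∧
      2 * (β - τ₂) / (τ₂ * (β - 1)) ≤ fourierDim (Tight ψ₁ ψ₂ θ) := by
  exact theorem2_general θ γ τ₁ τ₂ β ψ₁ ψ₂ hθ hψ₂_pos hψ_le hτ₁ hτ₂ hτ₁_gt hβ hβτ₂
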